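/- Let $d\ge 2$, let $\mathscr H$ be a complex Hilbert space of dimension $d$ (for instance $\mathbb C^d$, so that operators are $d\times d$ matrices), let $\mathscr T_1$ be the real affine space of self-adjoint operators on $\mathscr H$ with trace $1$, and let $\mathscr D\subset\mathscr T_1$ be the set of density matrices, i.e. of the positive operators in $\mathscr T_1$. Put $$T_1=\Bigl\{\lambda\in\mathbb R^d:\sum_{i=1}^d\lambda_i=1\Bigr\},\qquad \Lambda=\bigl\{\lambda\in T_1\cap[0,1]^d:\lambda_1\ge\dots\ge\lambda_d\bigr\}.$$ By a volume measure on a finite-dimensional affine space we mean a nonzero translation-invariant Borel measure that is finite on compact sets (it is unique up to a positive factor). Let $u$ be the probability measure on $\mathscr T_1$ obtained by restricting a volume measure on $\mathscr T_1$ to $\mathscr D$ and normalizing it. Fix a volume measure on $T_1$. Then there is a constant $\mathcal N>0$ such that, for $\rho$ distributed according to $u$, the eigenvalues $\lambda_1\ge\lambda_2\ge\dots\ge\lambda_d$ of $\rho$ (repeated according to multiplicity) have a joint distribution that is concentrated on $\Lambda$ and has there the density $$f(\lambda_1,\dots,\lambda_d)=\mathcal N\prod_{1\le i<j\le d}|\lambda_i-\lambda_j|^2$$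 relative to the volume measure on $T_1$. Moreover, the eigenbasis is Haar-uniform and independent of the eigenvalues: for every orthonormal basis $b_1,\dots,b_d$ of $\mathscr H$, if $\lambda$ has the above distribution on $\Lambda$ and $U$ is an independent unitary operator on $\mathscr H$ distributed according to the normalized Haar measure of the unitary group, then $\sum_{i=1}^d\lambda_i\,|Ub_i\rangle\langle Ub_i|$ has distribution $u$. -/

import Mathlib

open MeasureTheory

noncomputable section

/-- `μ` is a volume measure on the affine subspace `A`: a nonzero Borel measure on `A`, finite on
compact sets, which is invariant under all translations of `A`. If `A` is nonempty and
finite-dimensional, such a measure exists and is unique up to a positive factor. -/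
structure IsVolumeMeasure {V : Type*} [AddCommGroup V] [Module ℝ V] [TopologicalSpace V]
    [MeasurableSpace V] (A : AffineSubspace ℝ V) (μ : Measure A) : Prop where
  ne_zero : μ ≠ 0
  lt_top_of_isCompact : ∀ K : Set A, IsCompact K → μ K < ⊤
  map_translation : ∀ (v : V) (hv : v ∈ A.direction),
    μ.map (fun x : A => (⟨v +ᵥ (x : V), A.vadd_mem_of_mem_direction hv x.2⟩ : A)) = μ

section Operators

variable (H : Type*) [NormedAddCommGroup H] [InnerProductSpace ℂ H] [CompleteSpace H]

/-- The real affine space of self-adjoint operators on `H` with trace one. -/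
def traceOneOperators : AffineSubspace ℝ (H →L[ℂ] H) where
  carrier := {A | IsSelfAdjoint A ∧ LinearMap.trace ℂ H (A : H →ₗ[ℂ] H) = 1}
  smul_vsub_vadd_mem' := by
    rintro c A B C ⟨hA, tA⟩ ⟨hB, tB⟩ ⟨hC, tC⟩
    refine ⟨?_, ?_⟩
    · exact ((IsSelfAdjoint.all c).smul (hA.sub hB)).add hC
    · have h : ((c • (A - B) + C : H →L[ℂ] H) : H →ₗ[ℂ] H)
          = (c : ℂ) • ((A : H →ₗ[ℂ] H) - (B : H →ₗ[ℂ] H)) + (C : H →ₗ[ℂ] H) := by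
        ext x
        simp
      change LinearMap.trace ℂ H ((c • (A - B) + C : H →L[ℂ] H) : H →ₗ[ℂ] H) = 1
      rw [h, map_add, map_smul, map_sub, tA, tB, tC]
      simp

/-- The density matrices on `H`, as a subset of the trace-one self-adjoint operators. -/
def densityMatrices : Set (traceOneOperators H) :=
  {ρ | (ρ : H →L[ℂ] H).IsPositive}

variable {H}

/-- The uniform distribution over the density matrices: a volume measure on the trace-one
self-adjoint operators, restricted to the density matrices and normalized. -/
def uniformDensityMatrix (vol : Measure (traceOneOperators H)) : Measure (traceOneOperators H) :=
  ProbabilityTheory.cond vol (densityMatrices H)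

end Operators

/-- The hyperplane of all vectors in `ℝ ^ d` whose coordinates sum to one. -/
def sumOnePlane (d : ℕ) : AffineSubspace ℝ (Fin d → ℝ) where
  carrier := {x | ∑ i, x i = 1}
  smul_vsub_vadd_mem' := by
    intro c x y z hx hy hz
    simp only [Set.mem_ofPred_eq] at hx hy hz
    simp [Finset.sum_add_distrib, ← Finset.mul_sum, hx, hy, hz]

/-- The points `x` of the hyperplane with `x 0 ≥ x 1 ≥ …` and all coordinates in `[0, 1]`. -/
def orderedSimplex (d : ℕ) : Set (sumOnePlane d) :=
  {x | (∀ i, (x : Fin d → ℝ) i ∈ Set.Icc (0 : ℝ) 1) ∧ Antitone (x : Fin d → ℝ)}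

/-- The measure on the hyperplane which is concentrated on the ordered simplex and has there the
density `N * ∏_{i < j} |x i - x j| ^ 2` relative to `vol`. -/
def eigenvalueLaw {d : ℕ} (N : ℝ) (vol : Measure (sumOnePlane d)) : Measure (sumOnePlane d) :=
  (vol.restrict (orderedSimplex d)).withDensity fun x =>
    ENNReal.ofReal (N * ∏ i : Fin d, ∏ j ∈ Finset.Ioi i,
      |(x : Fin d → ℝ) i - (x : Fin d → ℝ) j| ^ 2)

section Spectral

variable {H : Type*} [NormedAddCommGroup H] [InnerProductSpace ℂ H] [CompleteSpace H]

/-- The eigenvalues of a trace-one self-adjoint operator, in decreasing order and repeated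
according to multiplicity, as a point of the hyperplane. -/
def orderedEigenvalues [FiniteDimensional ℂ H] {d : ℕ} (hd : Module.finrank ℂ H = d)
    (ρ : traceOneOperators H) : sumOnePlane d :=
  ⟨(ContinuousLinearMap.isSelfAdjoint_iff_isSymmetric.mp ρ.2.1).eigenvalues hd, by
    have h := ρ.2.2.symm.trans
      ((ContinuousLinearMap.isSelfAdjoint_iff_isSymmetric.mp ρ.2.1).trace_eq_sum_eigenvalues hd)
    change ∑ i, (ContinuousLinearMap.isSelfAdjoint_iff_isSymmetric.mp ρ.2.1).eigenvalues hd i = 1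
    exact RCLike.ofReal_injective (K := ℂ) (h.symm.trans RCLike.ofReal_one.symm)⟩

/-- The operator `∑ i, x i |U (b i)⟩⟨U (b i)|`, with eigenvalues `x i` and the orthonormal
eigenbasis `U (b i)`. -/
def spectralMap {d : ℕ} (b : OrthonormalBasis (Fin d) ℂ H)
    (p : sumOnePlane d × unitary (H →L[ℂ] H)) : H →L[ℂ] H :=
  ∑ i, (((p.1 : Fin d → ℝ) i : ℝ) : ℂ) •
    InnerProductSpace.rankOne ℂ ((p.2 : H →L[ℂ] H) (b i)) ((p.2 : H →L[ℂ] H) (b i))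

end Spectral

end

/-!
The spectral map `(x, U) ↦ ∑ x i |U (b i)⟩⟨U (b i)|` sends pairs of an ordered spectrum and a
unitary operator onto the self-adjoint operators of trace one. A volume measure there is invariant
under unitary conjugation, and averaging an invariant measure over the Haar measure of the
(unimodular) unitary group shows that it is the image, under the spectral map, of the product of its
eigenvalue distribution `ν` and the Haar measure (`map_spectralMapTraceOne_prod_haar`). This gives
the claim on the eigenbasis once `ν` is known.

To find `ν`, the frame of eigenvectors is parametrized near the basis `b` by `U(z) = exp (S(z))`,
where `S(z)` is the skew-adjoint operator with zero diagonal and upper entries `z`. The derivative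
of `(x, z) ↦ U(z) diag(x) U(z)*` is `U (diag(x') + [W, diag(x)]) U*` with `W = U* U'` skew-adjoint.
The commutator multiplies the entry `W j k` by `x k - x j`, so the Jacobian determinant is `∏_{j <
k} (x j - x k) ^ 2` times a function of `z` alone (`abs_det_chartDeriv`); the exponent `2` is the
real dimension of `ℂ`. By the inverse function theorem at `z = 0`, `z` is determined by the operator
for `z` in a neighbourhood `V` of `0` and strictly decreasing `x`, where one regular spectrum
suffices because two unitary operators that conjugate one regular diagonal operator in the same way
differ by a diagonal factor.

For a set `B` of strictly decreasing spectra, let the spectral box over `B` consist of the operators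
`U(z) diag(x) U(z)*` with `x ∈ B`, `z ∈ V`. The change of variables formula computes its volume as a
nonzero constant times `∫_B ∏ (x j - x k) ^ 2`; the averaging result computes it as `ν B` times the
Haar measure of the unitary operators that lie in `U(V)` up to a diagonal factor, which does not
depend on `B`. Comparison determines `ν` on regular spectra up to a factor. The box over the spectra
with repeated eigenvalues is null, since the Jacobian vanishes there, so these spectra are `ν`-null
(`exists_map_orderedEigenvalues_apply`). Finally, the density matrices are the operators with
spectrum in the ordered simplex, which is compact, and normalizing fixes the factor.
-/

set_option linter.unusedSectionVars false

noncomputable section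

/-! ### The spectral map -/

section SpectralDecomposition

variable {H : Type*} [NormedAddCommGroup H] [InnerProductSpace ℂ H] [CompleteSpace H]
  {d : ℕ} (b : OrthonormalBasis (Fin d) ℂ H)

/-- The operator that is diagonal in the orthonormal basis `b`, with real diagonal entries `x`,
as a real-linear function of `x`. -/
def diagOp : (Fin d → ℝ) →L[ℝ] (H →L[ℂ] H) :=
  ∑ i, (ContinuousLinearMap.proj (R := ℝ) (φ := fun _ : Fin d => ℝ) i).smulRight
    (InnerProductSpace.rankOne ℂ (b i) (b i))

lemma diagOp_eq_sum (x : Fin d → ℝ) :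
    diagOp b x = ∑ i, (x i : ℂ) • InnerProductSpace.rankOne ℂ (b i) (b i) := by
  simp [diagOp]

lemma diagOp_apply_basis (x : Fin d → ℝ) (i : Fin d) : diagOp b x (b i) = (x i : ℂ) • b i := by
  simp [diagOp_eq_sum, orthonormal_iff_ite.mp b.orthonormal]

lemma isSelfAdjoint_diagOp (x : Fin d → ℝ) : IsSelfAdjoint (diagOp b x) := by
  rw [diagOp_eq_sum]
  refine isSelfAdjoint_sum _ fun i _ => ?_
  refine IsSelfAdjoint.smul (Complex.conj_ofReal _) ?_
  exact ContinuousLinearMap.isSelfAdjoint_iff_isSymmetric.mpr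
    (InnerProductSpace.isSymmetric_rankOne_self _)

lemma trace_diagOp (x : Fin d → ℝ) :
    LinearMap.trace ℂ H (diagOp b x : H →ₗ[ℂ] H) = ((∑ i, x i : ℝ) : ℂ) := by
  rw [LinearMap.trace_eq_matrix_trace ℂ b.toBasis, Matrix.trace]
  simp [LinearMap.toMatrix_apply, diagOp_apply_basis, -Complex.coe_smul]

lemma trace_unitary_conj (U : unitary (H →L[ℂ] H)) (A : H →L[ℂ] H) :
    LinearMap.trace ℂ H (((U : H →L[ℂ] H) * A * star (U : H →L[ℂ] H) : H →L[ℂ] H) : H →ₗ[ℂ] H)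
      = LinearMap.trace ℂ H (A : H →ₗ[ℂ] H) := by
  have h : (((U : H →L[ℂ] H) * A * star (U : H →L[ℂ] H) : H →L[ℂ] H) : H →ₗ[ℂ] H)
    = ((U : H →L[ℂ] H) : H →ₗ[ℂ] H) * (A : H →ₗ[ℂ] H)
      * ((star (U : H →L[ℂ] H) : H →L[ℂ] H) : H →ₗ[ℂ] H) := rfl
  have h' : ((star (U : H →L[ℂ] H) : H →L[ℂ] H) : H →ₗ[ℂ] H)
    * ((U : H →L[ℂ] H) : H →ₗ[ℂ] H) = 1 := by
    have := Unitary.coe_star_mul_self U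
    exact congrArg (fun T : H →L[ℂ] H => (T : H →ₗ[ℂ] H)) this
  rw [h, LinearMap.trace_mul_cycle, h', one_mul]

/-- Conjugation by a unitary operator, acting on the self-adjoint operators of trace one. -/
def conjTraceOne (U : unitary (H →L[ℂ] H)) (ρ : traceOneOperators H) : traceOneOperators H :=
  ⟨(U : H →L[ℂ] H) * ρ * star (U : H →L[ℂ] H), ρ.2.1.conjugate _, by
    rw [trace_unitary_conj]; exact ρ.2.2⟩

lemma spectralMap_eq (p : sumOnePlane d × unitary (H →L[ℂ] H)) :
    spectralMap b p = (p.2 : H →L[ℂ] H) * diagOp b p.1 * star (p.2 : H →L[ℂ] H) := by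
  simp only [spectralMap, diagOp_eq_sum, Finset.mul_sum, Finset.sum_mul]
  refine Finset.sum_congr rfl fun i _ => ?_
  ext v
  simp [ContinuousLinearMap.star_eq_adjoint, ContinuousLinearMap.adjoint_inner_right]

/-- `spectralMap` as a map into the self-adjoint operators of trace one. -/
def spectralMapTraceOne (p : sumOnePlane d × unitary (H →L[ℂ] H)) : traceOneOperators H :=
  ⟨spectralMap b p, by rw [spectralMap_eq]; exact (isSelfAdjoint_diagOp b _).conjugate _, by
    rw [spectralMap_eq, trace_unitary_conj, trace_diagOp]
    exact congrArg _ p.1.2⟩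

lemma conjTraceOne_spectralMapTraceOne (x : sumOnePlane d) (U W : unitary (H →L[ℂ] H)) :
    conjTraceOne U (spectralMapTraceOne b (x, W)) = spectralMapTraceOne b (x, U * W) := by
  refine Subtype.ext ?_
  simp [conjTraceOne, spectralMapTraceOne, spectralMap_eq, mul_assoc]

/-- The orthonormal basis obtained by applying a unitary operator to `b`. -/
def unitaryBasis (U : unitary (H →L[ℂ] H)) : OrthonormalBasis (Fin d) ℂ H :=
  b.map (Unitary.linearIsometryEquiv U)

lemma spectralMap_apply_basis (p : sumOnePlane d × unitary (H →L[ℂ] H)) (i : Fin d) :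
    spectralMap b p ((p.2 : H →L[ℂ] H) (b i))
      = ((p.1 : Fin d → ℝ) i : ℂ) • (p.2 : H →L[ℂ] H) (b i) := by
  have h : (star (p.2 : H →L[ℂ] H)) ((p.2 : H →L[ℂ] H) (b i)) = b i :=
    congrArg (fun T : H →L[ℂ] H => T (b i)) (Unitary.coe_star_mul_self p.2)
  rw [spectralMap_eq]
  simp [h, diagOp_apply_basis]

lemma continuous_spectralMap : Continuous (spectralMap b) := by
  have : spectralMap b = fun p => (p.2 : H →L[ℂ] H) * diagOp b p.1 * star (p.2 : H →L[ℂ] H) :=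
    funext (spectralMap_eq b)
  rw [this]
  fun_prop

lemma continuous_spectralMapTraceOne : Continuous (spectralMapTraceOne b) :=
  (continuous_spectralMap b).subtype_mk _

lemma continuous_conjTraceOne : Continuous
    fun p : traceOneOperators H × unitary (H →L[ℂ] H) => conjTraceOne p.2 p.1 := by
  refine Continuous.subtype_mk ?_ _
  fun_prop

section FiniteDimensional

variable [FiniteDimensional ℂ H]

lemma eigenvalues_eq_of_apply_basis {T : H →ₗ[ℂ] H} (hT : T.IsSymmetric)
    (hd : Module.finrank ℂ H = d) {x : Fin d → ℝ} (hx : Antitone x)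
    (h : ∀ i, T (b i) = (x i : ℂ) • b i) : hT.eigenvalues hd = x := by
  have hm : LinearMap.toMatrix b.toBasis b.toBasis T
      = Matrix.diagonal (RCLike.ofReal ∘ x) := by
    ext i j
    simp [LinearMap.toMatrix_apply, h, Matrix.diagonal_apply, -Complex.coe_smul]
    grind
  have hr : T.charpoly.roots = Multiset.map (RCLike.ofReal ∘ x) Finset.univ.val := by
    rw [← LinearMap.charpoly_toMatrix _ b.toBasis, hm, Matrix.charpoly_diagonal,
      Polynomial.roots_prod _ _ (by
        simp [Finset.prod_ne_zero_iff, Polynomial.X_sub_C_ne_zero])]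
    simp
  rw [← List.ofFn_inj, ← hT.sort_roots_charpoly_eq_eigenvalues, hr]
  simp_rw [Fin.univ_val_map, Multiset.map_coe, List.map_ofFn,
    Function.comp_def, RCLike.ofReal_re, Multiset.coe_sort]
  apply List.mergeSort_of_pairwise
  simp_rw [decide_eq_true_eq, ← List.sortedGE_iff_pairwise]
  exact hx.sortedGE_ofFn

lemma orderedEigenvalues_spectralMapTraceOne (hd : Module.finrank ℂ H = d) (x : sumOnePlane d)
    (hx : Antitone (x : Fin d → ℝ)) (U : unitary (H →L[ℂ] H)) :
    orderedEigenvalues hd (spectralMapTraceOne b (x, U)) = x := by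
  refine Subtype.ext ?_
  exact eigenvalues_eq_of_apply_basis (unitaryBasis b U) _ hd hx
    fun i => spectralMap_apply_basis b (x, U) i

lemma antitone_orderedEigenvalues (hd : Module.finrank ℂ H = d) (ρ : traceOneOperators H) :
    Antitone (orderedEigenvalues hd ρ : Fin d → ℝ) :=
  LinearMap.IsSymmetric.eigenvalues_antitone _ hd

lemma exists_spectralMapTraceOne_eq (hd : Module.finrank ℂ H = d) (ρ : traceOneOperators H) :
    ∃ U, spectralMapTraceOne b (orderedEigenvalues hd ρ, U) = ρ := by
  have hs := ContinuousLinearMap.isSelfAdjoint_iff_isSymmetric.mp ρ.2.1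
  let e := b.equiv (hs.eigenvectorBasis hd) (Equiv.refl _)
  refine ⟨Unitary.linearIsometryEquiv.symm e, Subtype.ext ?_⟩
  have hb : ∀ i, ((Unitary.linearIsometryEquiv.symm e : unitary (H →L[ℂ] H)) : H →L[ℂ] H) (b i)
      = hs.eigenvectorBasis hd i := fun i => by
    simp [e]
  refine ContinuousLinearMap.coe_injective ((hs.eigenvectorBasis hd).toBasis.ext fun i => ?_)
  have := spectralMap_apply_basis b
    (orderedEigenvalues hd ρ, Unitary.linearIsometryEquiv.symm e) i
  simp only [hb] at this
  simp only [OrthonormalBasis.coe_toBasis]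
  refine this.trans ?_
  exact (hs.apply_eigenvectorBasis hd i).symm

instance compactSpace_unitary : CompactSpace (unitary (H →L[ℂ] H)) := by
  refine isCompact_iff_compactSpace.mp (Metric.isCompact_of_isClosed_isBounded isClosed_unitary ?_)
  refine (Metric.isBounded_closedBall (x := (0 : H →L[ℂ] H)) (r := 1)).subset fun U hU => ?_
  rw [mem_closedBall_zero_iff]
  rcases subsingleton_or_nontrivial (H →L[ℂ] H) with h | h
  · simp [Subsingleton.elim U 0]
  · exact (CStarRing.norm_of_mem_unitary hU).le

/-- The preimage of a compact set of spectra is the image of a compact set under the spectral map,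
so preimages of closed sets are countable unions of compact sets. -/
lemma measurable_orderedEigenvalues (hd : Module.finrank ℂ H = d) :
    Measurable (orderedEigenvalues (H := H) hd) := by
  let b := (stdOrthonormalBasis ℂ H).reindex (finCongr hd)
  have hcl : IsClosed (sumOnePlane d : Set (Fin d → ℝ)) :=
    AffineSubspace.closed_of_finiteDimensional _
  let A : Set (sumOnePlane d) := {x | Antitone (x : Fin d → ℝ)}
  have hA : IsClosed A := isClosed_antitone.preimage continuous_subtype_val
  refine measurable_of_isClosed fun C hC => ?_
  have key : orderedEigenvalues (H := H) hd ⁻¹' C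
      = ⋃ n : ℕ, ⋃ K ∈ {K | K = C ∩ A ∩ ((↑) : _ → Fin d → ℝ) ⁻¹' Metric.closedBall 0 n},
        spectralMapTraceOne b '' (K ×ˢ Set.univ) := by
    ext ρ
    simp only [Set.mem_preimage, Set.mem_ofPred_eq, Set.iUnion_iUnion_eq_left, Set.mem_iUnion]
    constructor
    · intro h
      obtain ⟨U, hU⟩ := exists_spectralMapTraceOne_eq b hd ρ
      obtain ⟨n, hn⟩ := exists_nat_ge ‖(orderedEigenvalues hd ρ : Fin d → ℝ)‖
      exact ⟨n, (orderedEigenvalues hd ρ, U),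
        ⟨⟨⟨h, antitone_orderedEigenvalues hd ρ⟩, by simpa using hn⟩, trivial⟩, hU⟩
    · rintro ⟨n, ⟨x, U⟩, ⟨⟨⟨hxC, hxA⟩, -⟩, -⟩, rfl⟩
      rwa [orderedEigenvalues_spectralMapTraceOne b hd x hxA]
  rw [key]
  refine MeasurableSet.iUnion fun n => ?_
  simp only [Set.mem_ofPred_eq, Set.iUnion_iUnion_eq_left]
  have hK : IsCompact (C ∩ A ∩ ((↑) : sumOnePlane d → Fin d → ℝ) ⁻¹' Metric.closedBall 0 n) :=
    (hcl.isClosedEmbedding_subtypeVal.isCompact_preimage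
      (isCompact_closedBall (0 : Fin d → ℝ) n)).inter_left (hC.inter hA)
  exact ((hK.prod isCompact_univ).image (continuous_spectralMapTraceOne b)).isClosed.measurableSet

end FiniteDimensional

end SpectralDecomposition

/-! ### Averaging over the unitary group -/

section Averaging

variable {H : Type*} [NormedAddCommGroup H] [InnerProductSpace ℂ H] [CompleteSpace H]
  [FiniteDimensional ℂ H] {d : ℕ} (b : OrthonormalBasis (Fin d) ℂ H)

/-- Compact groups are unimodular: a Haar probability measure is also right invariant. -/
lemma map_mul_right_haar_probability {G : Type*} [Group G] [TopologicalSpace G]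
    [IsTopologicalGroup G] [CompactSpace G] [MeasurableSpace G] [BorelSpace G]
    (μ : Measure G) [μ.IsHaarMeasure] [IsProbabilityMeasure μ] (g : G) :
    μ.map (· * g) = μ := by
  have hm : Measurable (· * g : G → G) := (continuous_mul_const g).measurable
  have : IsProbabilityMeasure (μ.map (· * g)) := Measure.isProbabilityMeasure_map hm.aemeasurable
  have : (μ.map (· * g)).IsHaarMeasure :=
    { lt_top_of_isCompact := fun {K} _ => measure_lt_top _ K }
  exact Measure.isHaarMeasure_eq_of_isProbabilityMeasure _ _

/-- A conjugation-invariant measure on the self-adjoint operators of trace one is recovered from its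
eigenvalue distribution by choosing the eigenbasis Haar-uniformly and independently. -/
lemma map_spectralMapTraceOne_prod_haar (hd : Module.finrank ℂ H = d)
    (μ : Measure (traceOneOperators H)) [SFinite μ]
    (hμ : ∀ U : unitary (H →L[ℂ] H), μ.map (conjTraceOne U) = μ)
    (haar : Measure (unitary (H →L[ℂ] H))) [haar.IsHaarMeasure] [IsProbabilityMeasure haar] :
    ((μ.map (orderedEigenvalues hd)).prod haar).map (spectralMapTraceOne b) = μ := by
  have hspec := (continuous_spectralMapTraceOne b).measurable
  have hoe := measurable_orderedEigenvalues (H := H) hd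
  have hconj := (continuous_conjTraceOne (H := H)).measurable
  refine Measure.ext fun s hs => ?_
  rw [Measure.map_apply hspec hs, Measure.prod_apply (hspec hs),
    lintegral_map (measurable_measure_prodMk_left (hspec hs)) hoe]
  have h1 : ∀ ρ : traceOneOperators H,
      haar (Prod.mk (orderedEigenvalues hd ρ) ⁻¹' (spectralMapTraceOne b ⁻¹' s))
        = haar (Prod.mk ρ ⁻¹' ((fun p : traceOneOperators H × unitary (H →L[ℂ] H) =>
            conjTraceOne p.2 p.1) ⁻¹' s)) := by
    intro ρ
    obtain ⟨W, hW⟩ := exists_spectralMapTraceOne_eq b hd ρ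
    conv_lhs => rw [← map_mul_right_haar_probability haar W]
    rw [Measure.map_apply (continuous_mul_const W).measurable
      ((hspec hs).preimage measurable_prodMk_left)]
    congr 1
    ext U
    simp only [Set.mem_preimage]
    rw [← conjTraceOne_spectralMapTraceOne, hW]
  simp_rw [h1]
  rw [← Measure.prod_apply (hconj hs), Measure.prod_apply_symm (hconj hs)]
  have h2 : ∀ U : unitary (H →L[ℂ] H),
      μ ((fun ρ => (ρ, U)) ⁻¹' ((fun p : traceOneOperators H × unitary (H →L[ℂ] H) =>
            conjTraceOne p.2 p.1) ⁻¹' s)) = μ s := by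
    intro U
    conv_rhs => rw [← hμ U]
    have hU : Measurable (conjTraceOne U) :=
      hconj.comp (measurable_prodMk_right (y := U))
    rw [Measure.map_apply hU hs]
    rfl
  simp [h2]

end Averaging

/-! ### Coordinates on traceless self-adjoint operators -/

section Coordinates

/-- Strictly upper triangular positions in a `d × d` matrix. -/
abbrev UpperIndex (d : ℕ) : Type := {p : Fin d × Fin d // p.1 < p.2}

/-- Coordinates for traceless self-adjoint operators: the diagonal, which is a real vector with
coordinate sum zero, and the complex entries above the diagonal. -/
abbrev TracelessCoords (d : ℕ) : Type := (sumOnePlane d).direction × (UpperIndex d → ℂ)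

variable {H : Type*} [NormedAddCommGroup H] [InnerProductSpace ℂ H] [CompleteSpace H]
  {d : ℕ} (b : OrthonormalBasis (Fin d) ℂ H)

lemma mem_direction_sumOnePlane (hd0 : d ≠ 0) {v : Fin d → ℝ} :
    v ∈ (sumOnePlane d).direction ↔ ∑ i, v i = 0 := by
  have hp : (fun _ => (d : ℝ)⁻¹ : Fin d → ℝ) ∈ sumOnePlane d := by
    change ∑ _i : Fin d, (d : ℝ)⁻¹ = 1
    simp [hd0]
  rw [← AffineSubspace.vadd_mem_iff_mem_direction v hp]
  change ∑ i, (v i + (d : ℝ)⁻¹) = 1 ↔ _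
  simp [Finset.sum_add_distrib, hd0]

/-- A linear projection of `ℝ ^ d` onto the vectors with coordinate sum zero. -/
def tracelessProj (d : ℕ) : (Fin d → ℝ) →ₗ[ℝ] (sumOnePlane d).direction :=
  ((sumOnePlane d).direction.subtype.exists_leftInverse_of_injective
    (Submodule.ker_subtype _)).choose

lemma tracelessProj_coe (v : (sumOnePlane d).direction) : tracelessProj d v = v :=
  LinearMap.congr_fun ((sumOnePlane d).direction.subtype.exists_leftInverse_of_injective
    (Submodule.ker_subtype _)).choose_spec v

/-- The operator with zero diagonal and entries `z` above the diagonal, with respect to `b`; the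
entries below the diagonal are `s` times the conjugate ones, so that the operator is self-adjoint
for `s = 1` and skew-adjoint for `s = -1`. -/
def offDiagOp (s : ℝ) : (UpperIndex d → ℂ) →ₗ[ℝ] (H →L[ℂ] H) where
  toFun z := ∑ p : UpperIndex d,
    (z p • InnerProductSpace.rankOne ℂ (b p.1.1) (b p.1.2)
      + ((s : ℂ) * star (z p)) • InnerProductSpace.rankOne ℂ (b p.1.2) (b p.1.1))
  map_add' x y := by
    simp only [Pi.add_apply, star_add, mul_add, add_smul, ← Finset.sum_add_distrib]
    exact Finset.sum_congr rfl fun p _ => by abel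
  map_smul' r x := by
    simp only [Pi.smul_apply, Finset.smul_sum, smul_add, RingHom.id_apply, star_smul]
    refine Finset.sum_congr rfl fun p _ => ?_
    simp [← Complex.coe_smul, smul_smul, mul_left_comm]

lemma offDiagOp_apply (s : ℝ) (z : UpperIndex d → ℂ) : offDiagOp b s z = ∑ p : UpperIndex d,
    (z p • InnerProductSpace.rankOne ℂ (b p.1.1) (b p.1.2)
      + ((s : ℂ) * star (z p)) • InnerProductSpace.rankOne ℂ (b p.1.2) (b p.1.1)) := rfl

lemma inner_offDiagOp_self (s : ℝ) (z : UpperIndex d → ℂ) (i : Fin d) :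
    inner ℂ (b i) (offDiagOp b s z (b i)) = 0 := by
  simp only [offDiagOp_apply, sum_apply, inner_sum]
  refine Finset.sum_eq_zero fun p _ => ?_
  have h1 := p.2.ne
  simp only [add_apply, smul_apply, inner_add_right, inner_smul_right,
    InnerProductSpace.inner_right_rankOne_apply, orthonormal_iff_ite.mp b.orthonormal]
  rcases eq_or_ne i p.1.1 with rfl | h
  · simp [h1, h1.symm]
  · simp [h, h.symm]

lemma inner_offDiagOp_upper (s : ℝ) (z : UpperIndex d → ℂ) (p : UpperIndex d) :
    inner ℂ (b p.1.1) (offDiagOp b s z (b p.1.2)) = z p := by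
  simp only [offDiagOp_apply, sum_apply, inner_sum]
  rw [Finset.sum_eq_single p]
  · have h1 := p.2.ne
    simp only [add_apply, smul_apply, inner_add_right, inner_smul_right,
      InnerProductSpace.inner_right_rankOne_apply, orthonormal_iff_ite.mp b.orthonormal]
    simp [h1]
  · intro q _ hq
    have h1 := p.2
    have h2 := q.2
    have h3 : ¬ (q.1.1 = p.1.1 ∧ q.1.2 = p.1.2) := fun h => hq (Subtype.ext (Prod.ext h.1 h.2))
    simp only [add_apply, smul_apply, inner_add_right, inner_smul_right,
      InnerProductSpace.inner_right_rankOne_apply, orthonormal_iff_ite.mp b.orthonormal]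
    split_ifs <;> simp_all; omega
  · simp

lemma star_rankOne (x y : H) :
    star (InnerProductSpace.rankOne ℂ x y) = InnerProductSpace.rankOne ℂ y x := by
  rw [ContinuousLinearMap.star_eq_adjoint, InnerProductSpace.adjoint_rankOne]

lemma isSelfAdjoint_offDiagOp_one (z : UpperIndex d → ℂ) : IsSelfAdjoint (offDiagOp b 1 z) := by
  rw [IsSelfAdjoint, offDiagOp_apply, star_sum]
  refine Finset.sum_congr rfl fun p _ => ?_
  simp [star_rankOne, add_comm]

lemma offDiagOp_neg_one_mem_skewAdjoint (z : UpperIndex d → ℂ) :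
    offDiagOp b (-1) z ∈ skewAdjoint (H →L[ℂ] H) := by
  rw [skewAdjoint.mem_iff, offDiagOp_apply, star_sum, ← Finset.sum_neg_distrib]
  refine Finset.sum_congr rfl fun p _ => ?_
  simp [star_rankOne]

lemma inner_diagOp (x : Fin d → ℝ) (i j : Fin d) :
    inner ℂ (b i) (diagOp b x (b j)) = if i = j then (x j : ℂ) else 0 := by
  rw [diagOp_apply_basis, inner_smul_right, orthonormal_iff_ite.mp b.orthonormal]
  simp

lemma ext_of_inner_basis {A B : H →L[ℂ] H}
    (h : ∀ i j, inner ℂ (b i) (A (b j)) = inner ℂ (b i) (B (b j))) : A = B :=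
  ContinuousLinearMap.coe_injective <| b.toBasis.ext fun j => by
    exact InnerProductSpace.ext_inner_left_basis b.toBasis fun i => by simpa using h i j

lemma IsSelfAdjoint.inner_swap {A : H →L[ℂ] H} (hA : IsSelfAdjoint A) (x y : H) :
    inner ℂ x (A y) = star (inner ℂ y (A x)) := by
  have := ContinuousLinearMap.isSelfAdjoint_iff_isSymmetric.mp hA x y
  simp only [ContinuousLinearMap.coe_coe] at this
  rw [← this, ← inner_conj_symm]; rfl

/-- A self-adjoint operator is determined by its entries on and above the diagonal. -/
lemma IsSelfAdjoint.ext_of_inner_basis {A B : H →L[ℂ] H} (hA : IsSelfAdjoint A)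
    (hB : IsSelfAdjoint B) (hdiag : ∀ i, inner ℂ (b i) (A (b i)) = inner ℂ (b i) (B (b i)))
    (hup : ∀ p : UpperIndex d,
      inner ℂ (b p.1.1) (A (b p.1.2)) = inner ℂ (b p.1.1) (B (b p.1.2))) : A = B := by
  refine _root_.ext_of_inner_basis b fun i j => ?_
  rcases lt_trichotomy i j with h | rfl | h
  · exact hup ⟨(i, j), h⟩
  · exact hdiag i
  · rw [hA.inner_swap, hB.inner_swap]
    exact congrArg star (hup ⟨(j, i), h⟩)

variable [FiniteDimensional ℂ H]

/-- The self-adjoint operator with given coordinates. -/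
def ofCoords : TracelessCoords d →L[ℝ] (H →L[ℂ] H) :=
  LinearMap.toContinuousLinearMap <|
    ((diagOp b : (Fin d → ℝ) →ₗ[ℝ] (H →L[ℂ] H)) ∘ₗ (sumOnePlane d).direction.subtype).coprod
      (offDiagOp b 1)

lemma ofCoords_apply (f : TracelessCoords d) :
    ofCoords b f = diagOp b f.1 + offDiagOp b 1 f.2 := rfl

/-- The coordinates of an operator; only meaningful for traceless self-adjoint operators. -/
def toCoords : (H →L[ℂ] H) →L[ℝ] TracelessCoords d :=
  LinearMap.toContinuousLinearMap
    { toFun := fun A => (tracelessProj d fun i => (inner ℂ (b i) (A (b i))).re,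
        fun p => inner ℂ (b p.1.1) (A (b p.1.2)))
      map_add' := fun A B => by
        simp only [add_apply, inner_add_right, Complex.add_re]
        refine Prod.ext ?_ rfl
        exact map_add (tracelessProj d) _ _
      map_smul' := fun r A => by
        simp only [RingHom.id_apply]
        refine Prod.ext ?_ ?_
        · change tracelessProj d _ = r • tracelessProj d _
          rw [← map_smul]
          congr 1
          ext i
          simp
        · funext p
          simp }

lemma toCoords_apply (A : H →L[ℂ] H) :
    toCoords b A = (tracelessProj d fun i => (inner ℂ (b i) (A (b i))).re,
        fun p => inner ℂ (b p.1.1) (A (b p.1.2))) := rfl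

lemma inner_ofCoords_self (f : TracelessCoords d) (i : Fin d) :
    inner ℂ (b i) (ofCoords b f (b i)) = ((f.1 : Fin d → ℝ) i : ℂ) := by
  simp only [ofCoords_apply, add_apply, inner_add_right, inner_offDiagOp_self, inner_diagOp]
  simp

lemma inner_ofCoords_upper (f : TracelessCoords d) (p : UpperIndex d) :
    inner ℂ (b p.1.1) (ofCoords b f (b p.1.2)) = f.2 p := by
  simp only [ofCoords_apply, add_apply, inner_add_right, inner_offDiagOp_upper, inner_diagOp]
  simp [p.2.ne]

lemma isSelfAdjoint_ofCoords (f : TracelessCoords d) : IsSelfAdjoint (ofCoords b f) :=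
  (isSelfAdjoint_diagOp b _).add (isSelfAdjoint_offDiagOp_one b _)

lemma toCoords_ofCoords (f : TracelessCoords d) : toCoords b (ofCoords b f) = f := by
  refine Prod.ext ?_ ?_
  · simp only [toCoords_apply, inner_ofCoords_self, Complex.ofReal_re]
    exact tracelessProj_coe f.1
  · funext p
    exact inner_ofCoords_upper b f p

lemma trace_eq_sum_inner (A : H →L[ℂ] H) :
    LinearMap.trace ℂ H (A : H →ₗ[ℂ] H) = ∑ i, inner ℂ (b i) (A (b i)) :=
  LinearMap.trace_eq_sum_inner _ b

lemma trace_ofCoords (hd0 : d ≠ 0) (f : TracelessCoords d) :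
    LinearMap.trace ℂ H (ofCoords b f : H →ₗ[ℂ] H) = 0 := by
  rw [trace_eq_sum_inner b]
  simp only [inner_ofCoords_self]
  exact_mod_cast (mem_direction_sumOnePlane hd0).mp f.1.2

lemma ofCoords_toCoords (hd0 : d ≠ 0) {A : H →L[ℂ] H} (hA : IsSelfAdjoint A)
    (htr : LinearMap.trace ℂ H (A : H →ₗ[ℂ] H) = 0) : ofCoords b (toCoords b A) = A := by
  have hre : ∀ i, ((inner ℂ (b i) (A (b i))).re : ℂ) = inner ℂ (b i) (A (b i)) := fun i =>
    Complex.conj_eq_iff_re.mp (hA.inner_swap (b i) (b i)).symm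
  refine (isSelfAdjoint_ofCoords b _).ext_of_inner_basis b hA (fun i => ?_) fun p => ?_
  · have hmem : (fun i => (inner ℂ (b i) (A (b i))).re) ∈ (sumOnePlane d).direction := by
      rw [mem_direction_sumOnePlane hd0]
      rw [trace_eq_sum_inner b] at htr
      simpa using congrArg Complex.re htr
    rw [inner_ofCoords_self, toCoords_apply]
    have := tracelessProj_coe ⟨_, hmem⟩
    simp only at this ⊢
    rw [this, hre]
  · rw [inner_ofCoords_upper]
    rfl

end Coordinates

/-! ### The Jacobian of the spectral map -/

section Jacobian

variable {H : Type*} [NormedAddCommGroup H] [InnerProductSpace ℂ H] [CompleteSpace H]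
  [FiniteDimensional ℂ H] {d : ℕ} (b : OrthonormalBasis (Fin d) ℂ H)

/-- A family of unitary operators, transversal to the diagonal ones at `z = 0`: the exponential of
the skew-adjoint operator with zero diagonal and upper entries `z`. -/
def frame (z : UpperIndex d → ℂ) : H →L[ℂ] H := NormedSpace.exp (offDiagOp b (-1) z)

lemma frame_mem_unitary (z : UpperIndex d → ℂ) : frame b z ∈ unitary (H →L[ℂ] H) := by
  let _ : NormedAlgebra ℚ (H →L[ℂ] H) := NormedAlgebra.restrictScalars ℚ ℝ _
  exact NormedSpace.exp_mem_unitary_of_mem_skewAdjoint (offDiagOp_neg_one_mem_skewAdjoint b z)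

lemma star_frame_mul_frame (z : UpperIndex d → ℂ) : star (frame b z) * frame b z = 1 :=
  (Unitary.mem_iff.mp (frame_mem_unitary b z)).1

lemma frame_mul_star_frame (z : UpperIndex d → ℂ) : frame b z * star (frame b z) = 1 :=
  (Unitary.mem_iff.mp (frame_mem_unitary b z)).2

lemma frame_zero : frame b 0 = 1 := by simp [frame]

lemma contDiff_frame : ContDiff ℝ 1 (frame b) := by
  have h1 : ContDiff ℝ 1 (NormedSpace.exp : (H →L[ℂ] H) → (H →L[ℂ] H)) :=
    contDiff_iff_contDiffAt.mpr fun x => (NormedSpace.exp_analytic (𝕂 := ℝ) x).contDiffAt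
  have h2 : ContDiff ℝ 1 (offDiagOp b (-1)) :=
    (LinearMap.toContinuousLinearMap (offDiagOp b (-1))).contDiff
  exact h1.comp h2

lemma fderiv_frame_zero (w : UpperIndex d → ℂ) :
    fderiv ℝ (frame b) 0 w = offDiagOp b (-1) w := by
  have h1 : HasFDerivAt (NormedSpace.exp : (H →L[ℂ] H) → (H →L[ℂ] H))
      (1 : (H →L[ℂ] H) →L[ℝ] (H →L[ℂ] H)) (offDiagOp b (-1) 0) := by
    rw [map_zero]
    exact hasFDerivAt_exp_zero
  have h2 : HasFDerivAt (offDiagOp b (-1))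
      (LinearMap.toContinuousLinearMap (offDiagOp b (-1))) 0 :=
    (LinearMap.toContinuousLinearMap (offDiagOp b (-1))).hasFDerivAt
  have := (h1.comp 0 h2).fderiv
  change fderiv ℝ (NormedSpace.exp ∘ offDiagOp b (-1)) 0 w = _
  rw [this]
  rfl

/-- The logarithmic derivative of `frame`: the Maurer–Cartan form of the unitary group, pulled back
along `frame`. -/
def frameForm (z w : UpperIndex d → ℂ) : H →L[ℂ] H :=
  star (frame b z) * fderiv ℝ (frame b) z w

lemma fderiv_frame (z w : UpperIndex d → ℂ) :
    fderiv ℝ (frame b) z w = frame b z * frameForm b z w := by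
  rw [frameForm, ← mul_assoc, frame_mul_star_frame, one_mul]

/-- Differentiating `star (frame b z) * frame b z = 1`. -/
lemma star_frameForm (z w : UpperIndex d → ℂ) : star (frameForm b z w) = - frameForm b z w := by
  have h1 : HasFDerivAt (frame b) (fderiv ℝ (frame b) z) z :=
    ((contDiff_frame b).differentiable one_ne_zero z).hasFDerivAt
  have h2 := h1.star.mul' h1
  have h3 : (fun x => star (frame b x)) * frame b = fun _ => 1 :=
    funext fun x => star_frame_mul_frame b x
  rw [h3] at h2
  have h4 := DFunLike.congr_fun (h2.unique (hasFDerivAt_const _ _)) w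
  simp at h4
  rw [frameForm, star_mul, star_star, eq_neg_iff_add_eq_zero, add_comm]
  exact h4

/-- The spectral map `(x, z) ↦ U(z) diag(x) U(z)*`, written in coordinates. -/
def chart (f : TracelessCoords d) : TracelessCoords d :=
  toCoords b (frame b f.2 * diagOp b f.1 * star (frame b f.2))

lemma ofCoords_toCoords_conj (hd0 : d ≠ 0) (U : unitary (H →L[ℂ] H)) {A : H →L[ℂ] H}
    (hA : IsSelfAdjoint A) (htr : LinearMap.trace ℂ H (A : H →ₗ[ℂ] H) = 0) :
    ofCoords b (toCoords b ((U : H →L[ℂ] H) * A * star (U : H →L[ℂ] H)))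
      = (U : H →L[ℂ] H) * A * star (U : H →L[ℂ] H) :=
  ofCoords_toCoords b hd0 (hA.conjugate _) (by rw [trace_unitary_conj, htr])

lemma ofCoords_chart (hd0 : d ≠ 0) (f : TracelessCoords d) :
    ofCoords b (chart b f) = frame b f.2 * diagOp b f.1 * star (frame b f.2) :=
  ofCoords_toCoords_conj b hd0 ⟨frame b f.2, frame_mem_unitary b f.2⟩ (isSelfAdjoint_diagOp b _)
    (by rw [trace_diagOp, (mem_direction_sumOnePlane hd0).mp f.1.2]; simp)

/-- Conjugation by a unitary operator, written in coordinates. -/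
def conjCoords (U : H →L[ℂ] H) : TracelessCoords d →L[ℝ] TracelessCoords d :=
  LinearMap.toContinuousLinearMap
    ((toCoords b : (H →L[ℂ] H) →ₗ[ℝ] _) ∘ₗ LinearMap.mulLeft ℝ U ∘ₗ
      LinearMap.mulRight ℝ (star U) ∘ₗ (ofCoords b : TracelessCoords d →ₗ[ℝ] _))

lemma conjCoords_apply (U : H →L[ℂ] H) (f : TracelessCoords d) :
    conjCoords b U f = toCoords b (U * ofCoords b f * star U) := by
  simp [conjCoords, mul_assoc]

/-- Scaling of the entry in position `(j, k)` by the eigenvalue difference `x k - x j`. -/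
def gapScaling (x : Fin d → ℝ) : TracelessCoords d →L[ℝ] TracelessCoords d :=
  LinearMap.toContinuousLinearMap <| LinearMap.prodMap LinearMap.id <|
    LinearMap.pi fun p : UpperIndex d =>
      ((x p.1.2 - x p.1.1) • (LinearMap.id : ℂ →ₗ[ℝ] ℂ)) ∘ₗ LinearMap.proj p

lemma gapScaling_apply (x : Fin d → ℝ) (f : TracelessCoords d) :
    gapScaling x f = (f.1, fun p => (x p.1.2 - x p.1.1) • f.2 p) := rfl

/-- The square of the Vandermonde determinant. -/
def sqGap (x : Fin d → ℝ) : ℝ := ∏ p : UpperIndex d, (x p.1.2 - x p.1.1) ^ 2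

lemma sqGap_nonneg (x : Fin d → ℝ) : 0 ≤ sqGap x := Finset.prod_nonneg fun _ _ => sq_nonneg _

lemma det_gapScaling (x : Fin d → ℝ) : (gapScaling x).det = sqGap x := by
  have : ((gapScaling x : TracelessCoords d →L[ℝ] TracelessCoords d) :
      TracelessCoords d →ₗ[ℝ] TracelessCoords d) = LinearMap.prodMap LinearMap.id (LinearMap.pi
        fun p : UpperIndex d =>
          ((x p.1.2 - x p.1.1) • (LinearMap.id : ℂ →ₗ[ℝ] ℂ)) ∘ₗ LinearMap.proj p) := rfl
  rw [ContinuousLinearMap.det, this, LinearMap.det_prodMap, LinearMap.det_pi]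
  simp [LinearMap.det_smul, Complex.finrank_real_complex, sqGap]

/-- The entries above the diagonal of the logarithmic derivative of `frame`. -/
def frameCoords (z : UpperIndex d → ℂ) : TracelessCoords d →L[ℝ] TracelessCoords d :=
  LinearMap.toContinuousLinearMap
    { toFun := fun f => (f.1, fun p => inner ℂ (b p.1.1) (frameForm b z f.2 (b p.1.2)))
      map_add' := fun f g => by
        refine Prod.ext rfl (funext fun p => ?_)
        simp [frameForm, mul_add]
      map_smul' := fun r f => by
        refine Prod.ext rfl (funext fun p => ?_)
        simp [frameForm] }

lemma frameCoords_apply (z : UpperIndex d → ℂ) (f : TracelessCoords d) : frameCoords b z f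
    = (f.1, fun p => inner ℂ (b p.1.1) (frameForm b z f.2 (b p.1.2))) := rfl

lemma frameCoords_zero : frameCoords b 0 = ContinuousLinearMap.id ℝ (TracelessCoords d) := by
  refine ContinuousLinearMap.ext fun f => Prod.ext rfl (funext fun p => ?_)
  simp [frameCoords_apply, frameForm, frame_zero, fderiv_frame_zero, inner_offDiagOp_upper]

/-- The commutator of the logarithmic derivative of `frame` with a diagonal operator only involves
the entries off the diagonal, which get multiplied by the eigenvalue differences. -/
lemma ofCoords_gapScaling_frameCoords (x : Fin d → ℝ) (z : UpperIndex d → ℂ)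
    (h : TracelessCoords d) :
    ofCoords b (gapScaling x (frameCoords b z h))
      = diagOp b h.1 + (frameForm b z h.2 * diagOp b x - diagOp b x * frameForm b z h.2) := by
  have hs : IsSelfAdjoint (diagOp b h.1
      + (frameForm b z h.2 * diagOp b x - diagOp b x * frameForm b z h.2)) := by
    refine (isSelfAdjoint_diagOp b _).add ?_
    rw [IsSelfAdjoint, star_sub, star_mul, star_mul, star_frameForm,
      (isSelfAdjoint_diagOp b x).star_eq]
    noncomm_ring
  have hent : ∀ i j, inner ℂ (b i) ((frameForm b z h.2 * diagOp b x
      - diagOp b x * frameForm b z h.2) (b j))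
      = (x j - x i : ℂ) * inner ℂ (b i) (frameForm b z h.2 (b j)) := by
    intro i j
    have h1 : inner ℂ (b i) ((diagOp b x) (frameForm b z h.2 (b j)))
        = (x i : ℂ) * inner ℂ (b i) (frameForm b z h.2 (b j)) := by
      rw [(isSelfAdjoint_diagOp b x).inner_swap, diagOp_apply_basis, inner_smul_right,
        ← inner_conj_symm (b i)]
      simp
    simp only [sub_apply, mul_apply_eq_comp, inner_sub_right, h1,
      diagOp_apply_basis, map_smul, inner_smul_right]
    ring
  refine (isSelfAdjoint_ofCoords b _).ext_of_inner_basis b hs (fun i => ?_) fun p => ?_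
  · rw [inner_ofCoords_self, add_apply, inner_add_right, hent, inner_diagOp]
    simp [gapScaling_apply, frameCoords_apply]
  · rw [inner_ofCoords_upper, add_apply, inner_add_right, hent, inner_diagOp]
    simp [gapScaling_apply, frameCoords_apply, p.2.ne, -Complex.coe_smul, ← Complex.coe_smul]

/-- The Fréchet derivative of `chart`. -/
def chartDeriv (f : TracelessCoords d) : TracelessCoords d →L[ℝ] TracelessCoords d :=
  conjCoords b (frame b f.2) ∘L gapScaling (f.1 : Fin d → ℝ) ∘L frameCoords b f.2

/-- Differentiating `U diag(x) U*` gives `U (diag(x') + [W, diag(x)]) U*`, where `W` is the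
logarithmic derivative of `U`. -/
lemma hasFDerivAt_chart (f : TracelessCoords d) :
    HasFDerivAt (chart b) (chartDeriv b f) f := by
  have hU : HasFDerivAt (fun f : TracelessCoords d => frame b f.2)
      (fderiv ℝ (frame b) f.2 ∘L ContinuousLinearMap.snd ℝ _ _) f :=
    HasFDerivAt.comp f ((contDiff_frame b).differentiable one_ne_zero f.2).hasFDerivAt
      hasFDerivAt_snd
  have hD : HasFDerivAt (fun f : TracelessCoords d => diagOp b f.1)
      (diagOp b ∘L (sumOnePlane d).direction.subtypeL ∘L ContinuousLinearMap.fst ℝ _ _) f :=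
    ContinuousLinearMap.hasFDerivAt
      (diagOp b ∘L (sumOnePlane d).direction.subtypeL ∘L ContinuousLinearMap.fst ℝ
        (sumOnePlane d).direction (UpperIndex d → ℂ))
  have := (toCoords b).hasFDerivAt.comp f ((hU.mul' hD).mul' hU.star)
  refine this.congr_fderiv (ContinuousLinearMap.ext fun h => ?_)
  simp only [chartDeriv, ContinuousLinearMap.comp_apply, conjCoords_apply,
    ofCoords_gapScaling_frameCoords]
  congr 1
  simp [fderiv_frame, star_frameForm]
  noncomm_ring

/-- The factor of the Jacobian determinant of `chart` that does not depend on the eigenvalues. -/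
def frameJacobian (z : UpperIndex d → ℂ) : ℝ :=
  |(conjCoords b (frame b z)).det * (frameCoords b z).det|

/-- The Jacobian determinant of `chart` is the product of the squared Vandermonde determinant of the
eigenvalues and a function of the eigenbasis. -/
lemma abs_det_chartDeriv (f : TracelessCoords d) :
    |(chartDeriv b f).det| = sqGap (f.1 : Fin d → ℝ) * frameJacobian b f.2 := by
  have : (chartDeriv b f).det
      = (conjCoords b (frame b f.2)).det
        * ((gapScaling (f.1 : Fin d → ℝ)).det * (frameCoords b f.2).det) := by
    simp only [chartDeriv, ContinuousLinearMap.det, ContinuousLinearMap.toLinearMap_comp,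
      LinearMap.det_comp]
  rw [this, det_gapScaling, mul_left_comm, abs_mul, abs_of_nonneg (sqGap_nonneg _), frameJacobian]

end Jacobian

/-! ### Volume measures in coordinates and unitary invariance -/

section VolumeMeasure

/-- Pulling a volume measure on an affine subspace back along an affine parametrization by a
finite-dimensional vector space gives a Haar measure. -/
lemma IsVolumeMeasure.isAddHaarMeasure_map {V : Type*} [AddCommGroup V] [Module ℝ V]
    [TopologicalSpace V] [MeasurableSpace V] [BorelSpace V] [ContinuousAdd V]
    {A : AffineSubspace ℝ V}
    {μ : Measure A} (hμ : IsVolumeMeasure A μ) {E : Type*} [NormedAddCommGroup E]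
    [NormedSpace ℝ E] [FiniteDimensional ℝ E] [MeasurableSpace E] [BorelSpace E] (φ : E ≃ₜ A)
    (hφ : ∀ e, ∃ v ∈ A.direction, ∀ f, (φ (e + f) : V) = v + φ f) :
    (μ.map φ.symm).IsAddHaarMeasure := by
  have : ProperSpace E := FiniteDimensional.proper_real E
  have hm : Measurable φ.symm := φ.symm.continuous.measurable
  have hinv : (μ.map φ.symm).IsAddLeftInvariant := ⟨fun e => by
    obtain ⟨v, hv, h⟩ := hφ e
    have hT : Measurable (fun x : A =>
        (⟨v +ᵥ (x : V), A.vadd_mem_of_mem_direction hv x.2⟩ : A)) := by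
      refine (Continuous.subtype_mk ?_ _).measurable
      exact (continuous_const.add continuous_subtype_val)
    conv_rhs => rw [← hμ.map_translation v hv]
    rw [Measure.map_map (by fun_prop) hm, Measure.map_map hm hT]
    congr 1
    funext x
    refine φ.injective (Subtype.ext ?_)
    simp [h]⟩
  have hfin : IsFiniteMeasureOnCompacts (μ.map φ.symm) := ⟨fun K hK => by
    rw [Measure.map_apply hm hK.isClosed.measurableSet]
    refine hμ.lt_top_of_isCompact _ ?_
    rw [← φ.image_eq_preimage_symm]
    exact hK.image φ.continuous⟩
  have : NeZero (μ.map φ.symm) := ⟨fun h =>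
    hμ.ne_zero ((Measure.map_eq_zero_iff hm.aemeasurable).mp h)⟩
  have := isOpenPosMeasure_of_addLeftInvariant_of_regular (μ := μ.map φ.symm)
  exact {}

end VolumeMeasure

section AffineCoordinates

/-- The vector in `ℝ ^ d` with all coordinates equal to `1 / d`. -/
def uniformVec (d : ℕ) : Fin d → ℝ := fun _ => (d : ℝ)⁻¹

variable {d : ℕ}

lemma uniformVec_mem (hd0 : d ≠ 0) : uniformVec d ∈ sumOnePlane d := by
  change ∑ _i : Fin d, (d : ℝ)⁻¹ = 1
  simp [hd0]

/-- Translation by `uniformVec d` identifies the vectors with coordinate sum zero with the vectors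
with coordinate sum one. -/
def planeEquiv (hd0 : d ≠ 0) : (sumOnePlane d).direction ≃ₜ sumOnePlane d where
  toFun x := ⟨(x : Fin d → ℝ) + uniformVec d,
    AffineSubspace.vadd_mem_of_mem_direction x.2 (uniformVec_mem hd0)⟩
  invFun y := ⟨(y : Fin d → ℝ) - uniformVec d,
    AffineSubspace.vsub_mem_direction y.2 (uniformVec_mem hd0)⟩
  left_inv x := Subtype.ext (add_sub_cancel_right _ _)
  right_inv y := Subtype.ext (sub_add_cancel _ _)
  continuous_toFun := by fun_prop
  continuous_invFun := by fun_prop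

lemma coe_planeEquiv (hd0 : d ≠ 0) (x : (sumOnePlane d).direction) :
    (planeEquiv hd0 x : Fin d → ℝ) = (x : Fin d → ℝ) + uniformVec d := rfl

lemma IsVolumeMeasure.isAddHaarMeasure_map_planeEquiv (hd0 : d ≠ 0)
    {μ : Measure (sumOnePlane d)} (hμ : IsVolumeMeasure (sumOnePlane d) μ) :
    (μ.map (planeEquiv hd0).symm).IsAddHaarMeasure :=
  hμ.isAddHaarMeasure_map _ fun e => ⟨e, e.2, fun f => by
    simp [coe_planeEquiv, add_assoc]⟩

variable {H : Type*} [NormedAddCommGroup H] [InnerProductSpace ℂ H] [CompleteSpace H]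
  [FiniteDimensional ℂ H] (b : OrthonormalBasis (Fin d) ℂ H)

lemma diagOp_uniformVec : diagOp b (uniformVec d) = ((d : ℂ)⁻¹) • (1 : H →L[ℂ] H) := by
  refine ContinuousLinearMap.coe_injective (b.toBasis.ext fun i => ?_)
  simp [diagOp_apply_basis, uniformVec, -Complex.coe_smul]

lemma conj_diagOp_add_uniformVec (U : unitary (H →L[ℂ] H)) (A : H →L[ℂ] H) :
    (U : H →L[ℂ] H) * (A + diagOp b (uniformVec d)) * star (U : H →L[ℂ] H)
      = (U : H →L[ℂ] H) * A * star (U : H →L[ℂ] H) + diagOp b (uniformVec d) := by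
  rw [diagOp_uniformVec, mul_add, add_mul]
  congr 1
  rw [mul_smul_comm, smul_mul_assoc, mul_one, Unitary.mul_star_self_of_mem U.2]

/-- The self-adjoint operators of trace one, parametrized by the coordinates of their traceless
part. -/
def traceOneEquiv (hd0 : d ≠ 0) : TracelessCoords d ≃ₜ traceOneOperators H where
  toFun f := ⟨ofCoords b f + diagOp b (uniformVec d),
    (isSelfAdjoint_ofCoords b f).add (isSelfAdjoint_diagOp b _), by
      have h := uniformVec_mem hd0
      change ∑ i, uniformVec d i = 1 at h
      rw [ContinuousLinearMap.toLinearMap_add, map_add, trace_ofCoords b hd0, trace_diagOp, h]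
      simp⟩
  invFun ρ := toCoords b (ρ - diagOp b (uniformVec d))
  left_inv f := by simp [toCoords_ofCoords]
  right_inv ρ := by
    refine Subtype.ext ?_
    have h := uniformVec_mem hd0
    change ∑ i, uniformVec d i = 1 at h
    simp only
    rw [ofCoords_toCoords b hd0 (ρ.2.1.sub (isSelfAdjoint_diagOp b _)), sub_add_cancel]
    rw [ContinuousLinearMap.toLinearMap_sub, map_sub, trace_diagOp, h, ρ.2.2]
    simp
  continuous_toFun := by fun_prop
  continuous_invFun := by fun_prop

lemma coe_traceOneEquiv (hd0 : d ≠ 0) (f : TracelessCoords d) :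
    (traceOneEquiv b hd0 f : H →L[ℂ] H) = ofCoords b f + diagOp b (uniformVec d) := rfl

lemma IsVolumeMeasure.isAddHaarMeasure_map_traceOneEquiv (hd0 : d ≠ 0)
    {μ : Measure (traceOneOperators H)} (hμ : IsVolumeMeasure (traceOneOperators H) μ) :
    (μ.map (traceOneEquiv b hd0).symm).IsAddHaarMeasure := by
  refine hμ.isAddHaarMeasure_map _ fun e => ⟨ofCoords b e, ?_, fun f => ?_⟩
  · have := AffineSubspace.vsub_mem_direction (traceOneEquiv b hd0 e).2
      (traceOneEquiv b hd0 0).2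
    simpa [coe_traceOneEquiv] using this
  · simp [coe_traceOneEquiv, add_assoc]

lemma traceOneEquiv_chart (hd0 : d ≠ 0) (x : (sumOnePlane d).direction) (z : UpperIndex d → ℂ) :
    traceOneEquiv b hd0 (chart b (x, z))
      = spectralMapTraceOne b (planeEquiv hd0 x, ⟨frame b z, frame_mem_unitary b z⟩) := by
  refine Subtype.ext ?_
  have := conj_diagOp_add_uniformVec b ⟨frame b z, frame_mem_unitary b z⟩ (diagOp b x)
  simp only at this
  simp [coe_traceOneEquiv, ofCoords_chart b hd0, spectralMapTraceOne, spectralMap_eq,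
    coe_planeEquiv, map_add, this]

lemma traceOneEquiv_conjCoords (hd0 : d ≠ 0) (U : unitary (H →L[ℂ] H)) (f : TracelessCoords d) :
    traceOneEquiv b hd0 (conjCoords b U f) = conjTraceOne U (traceOneEquiv b hd0 f) := by
  refine Subtype.ext ?_
  rw [coe_traceOneEquiv, conjCoords_apply, ofCoords_toCoords_conj b hd0 U
    (isSelfAdjoint_ofCoords b f) (trace_ofCoords b hd0 f), ← conj_diagOp_add_uniformVec]
  rfl

lemma measurable_conjTraceOne (U : unitary (H →L[ℂ] H)) : Measurable (conjTraceOne U) :=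
  (continuous_conjTraceOne.comp (continuous_id.prodMk (continuous_const (y := U)))).measurable

/-- Conjugation by a unitary operator is linear and preserves the unit ball of the operator norm,
so it preserves volumes. -/
lemma IsVolumeMeasure.map_conjTraceOne (hd : Module.finrank ℂ H = d) (hd0 : d ≠ 0)
    {μ : Measure (traceOneOperators H)} (hμ : IsVolumeMeasure (traceOneOperators H) μ)
    (U : unitary (H →L[ℂ] H)) : μ.map (conjTraceOne U) = μ := by
  let b := (stdOrthonormalBasis ℂ H).reindex (finCongr hd)
  have hHaar := hμ.isAddHaarMeasure_map_traceOneEquiv b hd0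
  set φ := traceOneEquiv b hd0
  set ν := μ.map φ.symm
  have hφ : Measurable φ := φ.continuous.measurable
  have hφs : Measurable φ.symm := φ.symm.continuous.measurable
  have hνμ : ν.map φ = μ := by
    rw [Measure.map_map hφ hφs]; simp
  have hcomp : ∀ (W : unitary (H →L[ℂ] H)) f,
      conjCoords b (star W : unitary (H →L[ℂ] H)) (conjCoords b W f) = f := fun W f => by
    refine φ.injective ?_
    rw [traceOneEquiv_conjCoords, traceOneEquiv_conjCoords]
    refine Subtype.ext ?_
    simp only [conjTraceOne, Unitary.coe_star, star_star]
    rw [mul_assoc, mul_assoc, mul_assoc, Unitary.coe_star_mul_self, mul_one, ← mul_assoc,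
      Unitary.coe_star_mul_self, one_mul]
  set L : TracelessCoords d →ₗ[ℝ] TracelessCoords d :=
    (conjCoords b (U : H →L[ℂ] H)).toLinearMap
  have hdet : LinearMap.det L ≠ 0 := by
    intro h0
    have h1 : (conjCoords b (star U : unitary (H →L[ℂ] H)) :
        TracelessCoords d →ₗ[ℝ] TracelessCoords d) ∘ₗ L = LinearMap.id :=
      LinearMap.ext (hcomp U)
    have h2 := congrArg LinearMap.det h1
    rw [LinearMap.det_comp, h0, mul_zero, LinearMap.det_id] at h2
    exact zero_ne_one h2
  have hL : Measurable L := (conjCoords b (U : H →L[ℂ] H)).continuous.measurable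
  have hmap := Measure.map_linearMap_addHaar_eq_smul_addHaar ν hdet
  -- A linear map that preserves a set of finite positive measure has determinant `±1`.
  let K : Set (TracelessCoords d) := {f | ‖ofCoords b f‖ ≤ 1}
  have hKc : IsClosed K := isClosed_le (by fun_prop) continuous_const
  have hLK : L ⁻¹' K = K := by
    ext f
    have h1 : ofCoords b (L f) = (U : H →L[ℂ] H) * ofCoords b f * star (U : H →L[ℂ] H) := by
      change ofCoords b (conjCoords b (U : H →L[ℂ] H) f) = _
      rw [conjCoords_apply, ofCoords_toCoords_conj b hd0 U
        (isSelfAdjoint_ofCoords b f) (trace_ofCoords b hd0 f)]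
    simp only [K, Set.mem_preimage, Set.mem_ofPred_eq, h1]
    rw [CStarRing.norm_mul_mem_unitary _ (Unitary.star_mem U.2),
      CStarRing.norm_mem_unitary_mul _ U.2]
  have hKtop : ν K ≠ ⊤ := by
    have : K ⊆ Metric.closedBall 0 ‖toCoords (d := d) b‖ := fun f hf => by
      rw [mem_closedBall_zero_iff, ← toCoords_ofCoords b f]
      exact ((toCoords b).le_opNorm _).trans (mul_le_of_le_one_right (norm_nonneg _) hf)
    exact ((measure_mono this).trans_lt measure_closedBall_lt_top).ne
  have hK0 : ν K ≠ 0 := by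
    have : K ∈ nhds (0 : TracelessCoords d) := by
      have hc : ContinuousAt (fun f => ‖ofCoords b f‖) 0 := by fun_prop
      have := hc.eventually_lt (continuousAt_const (y := (1 : ℝ))) (by simp)
      exact this.mono fun f hf => le_of_lt hf
    exact (Measure.measure_pos_of_mem_nhds ν this).ne'
  have hone : ENNReal.ofReal |(LinearMap.det L)⁻¹| = 1 := by
    have h1 := congrArg (fun m => m K) hmap
    simp only [Measure.map_apply hL hKc.measurableSet, hLK, Measure.smul_apply, smul_eq_mul] at h1
    exact (ENNReal.mul_eq_right hK0 hKtop).mp h1.symm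
  rw [hone, one_smul] at hmap
  conv_rhs => rw [← hνμ, ← hmap]
  conv_lhs => rw [← hνμ]
  rw [Measure.map_map (measurable_conjTraceOne U) hφ, Measure.map_map hφ hL]
  congr 1
  exact funext fun f => (traceOneEquiv_conjCoords b hd0 U f).symm

end AffineCoordinates

/-! ### Injectivity of the spectral map near a regular spectrum -/

section LocalChart

variable {H : Type*} [NormedAddCommGroup H] [InnerProductSpace ℂ H] [CompleteSpace H]
  [FiniteDimensional ℂ H] {d : ℕ} (b : OrthonormalBasis (Fin d) ℂ H)

lemma sqGap_pos {x : Fin d → ℝ} (hx : StrictAnti x) : 0 < sqGap x :=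
  Finset.prod_pos fun p _ => sq_pos_of_neg (sub_neg.mpr (hx p.2))

lemma sqGap_eq_zero {x : Fin d → ℝ} (hx : Antitone x) (hx' : ¬ StrictAnti x) : sqGap x = 0 := by
  have : ¬ Function.Injective x := fun h => hx' (hx.strictAnti_of_injective h)
  simp only [Function.Injective, not_forall] at this
  obtain ⟨i, j, hij, hne⟩ := this
  rcases lt_or_gt_of_ne hne with h | h
  · exact Finset.prod_eq_zero (Finset.mem_univ (⟨(i, j), h⟩ : UpperIndex d)) (by simp [hij])
  · exact Finset.prod_eq_zero (Finset.mem_univ (⟨(j, i), h⟩ : UpperIndex d)) (by simp [hij])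

lemma continuous_sqGap : Continuous (sqGap : (Fin d → ℝ) → ℝ) := by
  unfold sqGap; fun_prop

lemma sqGap_add_uniformVec (x : Fin d → ℝ) : sqGap (x + uniformVec d) = sqGap x := by
  simp [sqGap, uniformVec]

lemma sqGap_eq_prod_Ioi (x : Fin d → ℝ) :
    sqGap x = ∏ i : Fin d, ∏ j ∈ Finset.Ioi i, |x i - x j| ^ 2 := by
  rw [Finset.prod_sigma', sqGap]
  refine Finset.prod_bij (fun p _ => ⟨p.1.1, p.1.2⟩) (fun p _ => by simpa using p.2) ?_ ?_ ?_
  · rintro ⟨⟨i, j⟩, h⟩ - ⟨⟨i', j'⟩, h'⟩ - heq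
    simpa using heq
  · rintro ⟨i, j⟩ hij
    exact ⟨⟨(i, j), by simpa using hij⟩, Finset.mem_univ _, rfl⟩
  · intro p _
    rw [sq_abs]; ring

lemma frameJacobian_zero : frameJacobian b 0 = 1 := by
  have : conjCoords b (1 : H →L[ℂ] H) = ContinuousLinearMap.id ℝ (TracelessCoords d) :=
    ContinuousLinearMap.ext fun f => by simp [conjCoords_apply, toCoords_ofCoords]
  simp [frameJacobian, frame_zero, frameCoords_zero, this, ContinuousLinearMap.det]

lemma contDiff_chart : ContDiff ℝ 1 (chart b) := by
  have h1 : ContDiff ℝ 1 fun f : TracelessCoords d => frame b f.2 :=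
    (contDiff_frame b).comp contDiff_snd
  have h2 : ContDiff ℝ 1 fun f : TracelessCoords d => diagOp b f.1 :=
    (diagOp b ∘L (sumOnePlane d).direction.subtypeL ∘L ContinuousLinearMap.fst ℝ
        (sumOnePlane d).direction (UpperIndex d → ℂ)).contDiff
  have h3 : ContDiff ℝ 1 fun f : TracelessCoords d => star (frame b f.2) :=
    ((starL' ℝ : (H →L[ℂ] H) ≃L[ℝ] (H →L[ℂ] H)).contDiff).comp h1
  exact (toCoords b).contDiff.comp ((h1.mul h2).mul h3)

lemma exists_strictAnti (hd0 : d ≠ 0) :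
    ∃ x : (sumOnePlane d).direction, StrictAnti (x : Fin d → ℝ) := by
  let m : ℝ := (∑ i : Fin d, (i : ℝ)) / d
  refine ⟨⟨fun i => m - i, ?_⟩, fun i j hij => ?_⟩
  · rw [mem_direction_sumOnePlane hd0]
    have : (d : ℝ) ≠ 0 := by exact_mod_cast hd0
    simp [m]
    field_simp
    ring
  · simpa using hij

lemma continuous_frameJacobian (hd0 : d ≠ 0) : Continuous (frameJacobian b) := by
  obtain ⟨x, hx⟩ := exists_strictAnti hd0
  have h : frameJacobian b
      = fun z => |(fderiv ℝ (chart b) (x, z)).det| / sqGap (x : Fin d → ℝ) := by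
    funext z
    have := abs_det_chartDeriv b (x, z)
    rw [eq_div_iff (sqGap_pos hx).ne', (hasFDerivAt_chart b (x, z)).fderiv, mul_comm]
    exact this.symm
  rw [h]
  have h1 := (contDiff_chart b).continuous_fderiv one_ne_zero
  exact ((ContinuousLinearMap.continuous_det.comp (h1.comp (by fun_prop))).abs).div_const _

/-- If two unitary operators conjugate one diagonal operator with distinct entries in the same way,
they conjugate all diagonal operators in the same way: they differ by a diagonal factor. -/
lemma conj_diagOp_eq_of_injective {U W : H →L[ℂ] H} (hU : U ∈ unitary (H →L[ℂ] H))
    (hW : W ∈ unitary (H →L[ℂ] H)) {x : Fin d → ℝ} (hx : Function.Injective x)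
    (h : U * diagOp b x * star U = W * diagOp b x * star W) (y : Fin d → ℝ) :
    U * diagOp b y * star U = W * diagOp b y * star W := by
  have hUU := Unitary.star_mul_self_of_mem hU
  have hUU' := Unitary.mul_star_self_of_mem hU
  have hWW := Unitary.star_mul_self_of_mem hW
  have hWW' := Unitary.mul_star_self_of_mem hW
  have key : ∀ y : Fin d → ℝ, U * diagOp b y * star U = W * diagOp b y * star W ↔
      (star W * U) * diagOp b y = diagOp b y * (star W * U) := fun y => by
    constructor
    · intro h
      calc (star W * U) * diagOp b y = star W * (U * diagOp b y * star U) * U := by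
            simp only [mul_assoc, hUU, mul_one]
        _ = diagOp b y * (star W * U) := by
            rw [h]; simp only [← mul_assoc, hWW, one_mul]
    · intro h
      calc U * diagOp b y * star U = W * ((star W * U) * diagOp b y) * star U := by
            simp only [← mul_assoc, hWW', one_mul]
        _ = W * diagOp b y * star W := by
            rw [h]; simp only [mul_assoc, hUU', mul_one]
  rw [key] at h ⊢
  set C := star W * U
  have hent : ∀ (y : Fin d → ℝ) i j, inner ℂ (b i) ((C * diagOp b y) (b j))
      = (y j : ℂ) * inner ℂ (b i) (C (b j)) := fun y i j => by
    simp only [mul_apply_eq_comp, diagOp_apply_basis, map_smul, inner_smul_right]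
  have hent' : ∀ (y : Fin d → ℝ) i j, inner ℂ (b i) ((diagOp b y * C) (b j))
      = (y i : ℂ) * inner ℂ (b i) (C (b j)) := fun y i j => by
    rw [mul_apply_eq_comp, (isSelfAdjoint_diagOp b y).inner_swap, diagOp_apply_basis,
      inner_smul_right, ← inner_conj_symm (b i)]
    simp
  refine ext_of_inner_basis b fun i j => ?_
  rw [hent, hent']
  rcases eq_or_ne i j with rfl | hij
  · rfl
  · have h1 := congrArg (fun A : H →L[ℂ] H => inner ℂ (b i) (A (b j))) h
    simp only [hent, hent'] at h1
    have h2 : (x j : ℂ) ≠ x i := fun h' => hij (hx (Complex.ofReal_injective h').symm)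
    have h3 : inner ℂ (b i) (C (b j)) = 0 := by
      by_contra h4
      exact h2 (mul_right_cancel₀ h4 h1)
    rw [h3, mul_zero, mul_zero]

lemma spectralMapTraceOne_eq_of_injective {x : sumOnePlane d}
    (hx : Function.Injective (x : Fin d → ℝ)) {U W : unitary (H →L[ℂ] H)}
    (h : spectralMapTraceOne b (x, U) = spectralMapTraceOne b (x, W)) (y : sumOnePlane d) :
    spectralMapTraceOne b (y, U) = spectralMapTraceOne b (y, W) := by
  have h' := congrArg (fun ρ : traceOneOperators H => (ρ : H →L[ℂ] H)) h
  simp only [spectralMapTraceOne, spectralMap_eq] at h'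
  refine Subtype.ext ?_
  simp only [spectralMapTraceOne, spectralMap_eq]
  exact conj_diagOp_eq_of_injective b U.2 W.2 hx h' _

/-- Near `z = 0` the Jacobian of `chart` does not vanish, and by the inverse function theorem the
eigenbasis, up to phases, determines `z`. -/
lemma exists_isOpen_injOn_chart (hd0 : d ≠ 0) {x : (sumOnePlane d).direction}
    (hx : StrictAnti (x : Fin d → ℝ)) :
    ∃ V : Set (UpperIndex d → ℂ), IsOpen V ∧ 0 ∈ V ∧ (∀ z ∈ V, 0 < frameJacobian b z) ∧
      Set.InjOn (fun z => chart b (x, z)) V := by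
  have hst := (contDiff_chart b).contDiffAt.hasStrictFDerivAt (x := (x, 0)) one_ne_zero
  have hdet : (fderiv ℝ (chart b) (x, 0)).det ≠ 0 := by
    rw [(hasFDerivAt_chart b (x, 0)).fderiv, ← abs_pos]
    have := abs_det_chartDeriv b (x, 0)
    simp only [frameJacobian_zero, mul_one] at this
    exact this ▸ sqGap_pos hx
  rw [← ContinuousLinearMap.coe_toContinuousLinearEquivOfDetNeZero _ hdet] at hst
  let Φ := hst.toOpenPartialHomeomorph (chart b)
  refine ⟨(fun z => (x, z)) ⁻¹' Φ.source ∩ frameJacobian b ⁻¹' Set.Ioi 0,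
    (Φ.open_source.preimage (by fun_prop)).inter
      (isOpen_Ioi.preimage (continuous_frameJacobian b hd0)),
    ⟨hst.mem_toOpenPartialHomeomorph_source, ?_⟩, fun z hz => hz.2, ?_⟩
  · simp [frameJacobian_zero]
  · intro z hz w hw h
    exact congrArg Prod.snd (Φ.injOn hz.1 hw.1 h)

lemma injOn_chart (hd : Module.finrank ℂ H = d) (hd0 : d ≠ 0)
    {x₀ : (sumOnePlane d).direction} {V : Set (UpperIndex d → ℂ)}
    (hV : Set.InjOn (fun z => chart b (x₀, z)) V) :
    Set.InjOn (chart b) 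
      ({x : (sumOnePlane d).direction | StrictAnti (x : Fin d → ℝ)} ×ˢ V) := by
  rintro ⟨x, z⟩ ⟨hx, hz⟩ ⟨y, w⟩ ⟨hy, hw⟩ h
  simp only [Set.mem_ofPred_eq] at hx hy hz hw
  have hanti : ∀ {x : (sumOnePlane d).direction}, StrictAnti (x : Fin d → ℝ) →
      StrictAnti (planeEquiv hd0 x : Fin d → ℝ) := fun h i j hij => by
    simpa [coe_planeEquiv, uniformVec] using h hij
  -- The eigenvalues agree, and the unitary operators then agree up to a diagonal factor.
  have h' := congrArg (traceOneEquiv b hd0) h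
  rw [traceOneEquiv_chart, traceOneEquiv_chart] at h'
  have hxy : x = y := by
    have := congrArg (orderedEigenvalues hd) h'
    rw [orderedEigenvalues_spectralMapTraceOne b hd _ (hanti hx).antitone,
      orderedEigenvalues_spectralMapTraceOne b hd _ (hanti hy).antitone] at this
    exact (planeEquiv hd0).injective this
  subst hxy
  have h2 := spectralMapTraceOne_eq_of_injective b (hanti hx).injective h' (planeEquiv hd0 x₀)
  rw [← traceOneEquiv_chart, ← traceOneEquiv_chart] at h2
  rw [hV hz hw ((traceOneEquiv b hd0).injective h2)]

end LocalChart

/-! ### The ordered simplex and the density matrices -/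

section Simplex

variable {d : ℕ}

lemma isClosed_sumOnePlane : IsClosed (sumOnePlane d : Set (Fin d → ℝ)) :=
  AffineSubspace.closed_of_finiteDimensional _

lemma isCompact_orderedSimplex : IsCompact (orderedSimplex d) := by
  have h : orderedSimplex d = ((↑) : sumOnePlane d → Fin d → ℝ) ⁻¹'
      (Set.Icc 0 1 ∩ {x | Antitone x}) := by
    ext x
    simp only [orderedSimplex, Set.mem_ofPred_eq, Set.mem_preimage, Set.mem_inter_iff, Set.mem_Icc,
      Pi.le_def, Pi.zero_apply, Pi.one_apply, forall_and]
  rw [h]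
  exact isClosed_sumOnePlane.isClosedEmbedding_subtypeVal.isCompact_preimage
    (isCompact_Icc.inter_right isClosed_antitone)

lemma isOpen_setOf_strictAnti : IsOpen {x : Fin d → ℝ | StrictAnti x} := by
  have h : {x : Fin d → ℝ | StrictAnti x} = ⋂ p : UpperIndex d, {x | x p.1.2 < x p.1.1} := by
    ext x
    simp only [Set.mem_ofPred_eq, Set.mem_iInter]
    exact ⟨fun h p => h p.2, fun h i j hij => h ⟨(i, j), hij⟩⟩
  rw [h]
  exact isOpen_iInter_of_finite fun p => isOpen_lt (by fun_prop) (by fun_prop)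

lemma measurableSet_strictAnti : MeasurableSet {x : sumOnePlane d | StrictAnti (x : Fin d → ℝ)} :=
  (isOpen_setOf_strictAnti.preimage continuous_subtype_val).measurableSet

lemma measurableSet_antitone : MeasurableSet {x : sumOnePlane d | Antitone (x : Fin d → ℝ)} :=
  (isClosed_antitone.preimage continuous_subtype_val).measurableSet

lemma measurable_ofReal_sqGap :
    Measurable fun x : sumOnePlane d => ENNReal.ofReal (sqGap (x : Fin d → ℝ)) :=
  (ENNReal.continuous_ofReal.comp (continuous_sqGap.comp continuous_subtype_val)).measurable

lemma map_planeEquiv_map_symm (hd0 : d ≠ 0) (μ : Measure (sumOnePlane d)) :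
    (μ.map (planeEquiv hd0).symm).map (planeEquiv hd0) = μ := by
  rw [Measure.map_map (planeEquiv hd0).continuous.measurable
    (planeEquiv hd0).symm.continuous.measurable]
  simp

/-- The point with coordinates proportional to `d, d - 1, …, 1` has distinct coordinates in the open
unit interval. -/
lemma exists_strictAnti_mem_Ioo (hd2 : 2 ≤ d) :
    ∃ x : sumOnePlane d, StrictAnti (x : Fin d → ℝ) ∧
      ∀ i, (x : Fin d → ℝ) i ∈ Set.Ioo (0 : ℝ) 1 := by
  have hd : (2 : ℝ) ≤ d := by exact_mod_cast hd2
  have hsum : ∀ n : ℕ, ∑ i ∈ Finset.range n, (i : ℝ) = n * (n - 1) / 2 := fun n => by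
    induction n with
    | zero => simp
    | succ n ih => rw [Finset.sum_range_succ, ih]; push_cast; ring
  have hpos : (0 : ℝ) < d * (d + 1) := by positivity
  refine ⟨⟨fun i => 2 * (d - (i : ℕ)) / (d * (d + 1)), ?_⟩, fun i j hij => ?_, fun i => ⟨?_, ?_⟩⟩
  · change ∑ i : Fin d, 2 * ((d : ℝ) - (i : ℕ)) / (d * (d + 1)) = 1
    rw [← Finset.sum_div, ← Finset.mul_sum, Finset.sum_sub_distrib,
      Fin.sum_univ_eq_sum_range (fun i => (i : ℝ)), hsum]
    simp
    field_simp
    ring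
  · have : ((i : ℕ) : ℝ) < (j : ℕ) := by exact_mod_cast hij
    simp only
    gcongr
  · have : ((i : ℕ) : ℝ) < d := by exact_mod_cast i.2
    exact div_pos (by linarith) hpos
  · have : (0 : ℝ) ≤ (i : ℕ) := by positivity
    rw [div_lt_one hpos]
    nlinarith

lemma lintegral_sqGap_orderedSimplex_ne_zero (hd2 : 2 ≤ d) {μ : Measure (sumOnePlane d)}
    (hμ : IsVolumeMeasure (sumOnePlane d) μ) :
    ∫⁻ x in orderedSimplex d ∩ {x | StrictAnti (x : Fin d → ℝ)},
      ENNReal.ofReal (sqGap (x : Fin d → ℝ)) ∂μ ≠ 0 := by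
  have hd0 : d ≠ 0 := by omega
  have hHaar := hμ.isAddHaarMeasure_map_planeEquiv hd0
  rw [← pos_iff_ne_zero, setLIntegral_pos_iff measurable_ofReal_sqGap]
  let O : Set (sumOnePlane d) := ((↑) : sumOnePlane d → Fin d → ℝ) ⁻¹'
    ({x | StrictAnti x} ∩ Set.univ.pi fun _ => Set.Ioo (0 : ℝ) 1)
  have hO : IsOpen O := (isOpen_setOf_strictAnti.inter
    (isOpen_set_pi Set.finite_univ fun _ _ => isOpen_Ioo)).preimage continuous_subtype_val
  have hsub : O ⊆ (Function.support fun x : sumOnePlane d =>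
      ENNReal.ofReal (sqGap (x : Fin d → ℝ))) ∩
        (orderedSimplex d ∩ {x | StrictAnti (x : Fin d → ℝ)}) := by
    rintro x ⟨hx, hx'⟩
    simp only [Set.mem_pi, Set.mem_univ, true_implies] at hx'
    have hx0 : StrictAnti (x : Fin d → ℝ) := hx
    exact ⟨(ENNReal.ofReal_pos.mpr (sqGap_pos hx)).ne',
      ⟨fun i => Set.Ioo_subset_Icc_self (hx' i), hx0.antitone⟩, hx⟩
  refine lt_of_lt_of_le ?_ (measure_mono hsub)
  rw [← map_planeEquiv_map_symm hd0 μ, Measure.map_apply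
    (planeEquiv hd0).continuous.measurable hO.measurableSet]
  refine (hO.preimage (planeEquiv hd0).continuous).measure_pos _ ?_
  obtain ⟨x, hx, hx'⟩ := exists_strictAnti_mem_Ioo hd2
  exact ⟨(planeEquiv hd0).symm x, by simpa [O] using ⟨hx, hx'⟩⟩

lemma lintegral_sqGap_orderedSimplex_lt_top {μ : Measure (sumOnePlane d)}
    (hμ : IsVolumeMeasure (sumOnePlane d) μ) :
    ∫⁻ x in orderedSimplex d, ENNReal.ofReal (sqGap (x : Fin d → ℝ)) ∂μ < ⊤ := by
  have hS : MeasurableSet (orderedSimplex d) := isCompact_orderedSimplex.isClosed.measurableSet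
  refine (setLIntegral_mono' hS (g := fun _ => 1) fun x hx => ?_).trans_lt ?_
  · rw [ENNReal.ofReal_le_one]
    refine Finset.prod_le_one (fun p _ => sq_nonneg _) fun p _ => ?_
    have h1 := hx.1 p.1.1
    have h2 := hx.1 p.1.2
    rw [sq_le_one_iff_abs_le_one, abs_le]
    constructor <;> linarith [h1.1, h1.2, h2.1, h2.2]
  · rw [setLIntegral_one]
    exact hμ.lt_top_of_isCompact _ isCompact_orderedSimplex

variable {H : Type*} [NormedAddCommGroup H] [InnerProductSpace ℂ H] [CompleteSpace H]
  [FiniteDimensional ℂ H]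

open scoped ComplexOrder in
lemma densityMatrices_eq_preimage (hd : Module.finrank ℂ H = d) :
    densityMatrices H = orderedEigenvalues hd ⁻¹' orderedSimplex d := by
  ext ρ
  have hs := ContinuousLinearMap.isSelfAdjoint_iff_isSymmetric.mp ρ.2.1
  constructor
  · intro hρ
    have h0 : ∀ i, 0 ≤ (orderedEigenvalues hd ρ : Fin d → ℝ) i := fun i =>
      (ContinuousLinearMap.isPositive_toLinearMap_iff _ |>.mpr hρ).nonneg_eigenvalues hd i
    refine ⟨fun i => ⟨h0 i, ?_⟩, antitone_orderedEigenvalues hd ρ⟩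
    have h1 : ∑ i, (orderedEigenvalues hd ρ : Fin d → ℝ) i = 1 := (orderedEigenvalues hd ρ).2
    rw [← h1]
    exact Finset.single_le_sum (fun i _ => h0 i) (Finset.mem_univ i)
  · rintro ⟨hρ, -⟩
    let b := (stdOrthonormalBasis ℂ H).reindex (finCongr hd)
    obtain ⟨U, hU⟩ := exists_spectralMapTraceOne_eq b hd ρ
    change (ρ : H →L[ℂ] H).IsPositive
    rw [← hU]
    change (spectralMap b _).IsPositive
    have hpos : ∀ i, 0 ≤ (((orderedEigenvalues hd ρ : Fin d → ℝ) i : ℝ) : ℂ) := fun i => by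
      exact_mod_cast (hρ i).1
    exact ContinuousLinearMap.isPositive_sum _ fun i _ =>
      (InnerProductSpace.isPositive_rankOne_self _).smul_of_nonneg (hpos i)

lemma measurableSet_densityMatrices : MeasurableSet (densityMatrices H) := by
  rw [densityMatrices_eq_preimage rfl]
  exact measurable_orderedEigenvalues rfl isCompact_orderedSimplex.isClosed.measurableSet

lemma isCompact_densityMatrices : IsCompact (densityMatrices H) := by
  have h : densityMatrices H = spectralMapTraceOne (stdOrthonormalBasis ℂ H) ''
      (orderedSimplex (Module.finrank ℂ H) ×ˢ Set.univ) := by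
    rw [densityMatrices_eq_preimage rfl]
    ext ρ
    constructor
    · intro hρ
      obtain ⟨U, hU⟩ := exists_spectralMapTraceOne_eq (stdOrthonormalBasis ℂ H) rfl ρ
      exact ⟨(_, U), ⟨hρ, trivial⟩, hU⟩
    · rintro ⟨⟨x, U⟩, ⟨hx, -⟩, rfl⟩
      rw [Set.mem_preimage, orderedEigenvalues_spectralMapTraceOne _ rfl x hx.2]
      exact hx
  rw [h]
  exact (isCompact_orderedSimplex.prod isCompact_univ).image (continuous_spectralMapTraceOne _)

end Simplex

/-! ### The eigenvalue distribution of a volume measure -/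

section EigenvalueDistribution

variable {H : Type*} [NormedAddCommGroup H] [InnerProductSpace ℂ H] [CompleteSpace H]
  [FiniteDimensional ℂ H] {d : ℕ} (b : OrthonormalBasis (Fin d) ℂ H)

/-- The frame at `z`, as an element of the unitary group. -/
def unitaryFrame (z : UpperIndex d → ℂ) : unitary (H →L[ℂ] H) := ⟨frame b z, frame_mem_unitary b z⟩

/-- The operators whose spectrum lies in `B` and which are diagonal in an eigenbasis that belongs
to a parameter in `V`. -/
def spectralBox (V : Set (UpperIndex d → ℂ)) (B : Set (sumOnePlane d)) :
    Set (traceOneOperators H) :=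
  spectralMapTraceOne b '' (B ×ˢ (unitaryFrame b '' V))

/-- The unitary operators that agree with the frame of some parameter in `V` up to a diagonal
factor; the condition is expressed by their action on a single diagonal operator. -/
def phaseSaturation (V : Set (UpperIndex d → ℂ)) (x₀ : sumOnePlane d) :
    Set (unitary (H →L[ℂ] H)) :=
  {U | ∃ z ∈ V, spectralMapTraceOne b (x₀, U) = spectralMapTraceOne b (x₀, unitaryFrame b z)}

lemma spectralMapTraceOne_mem_spectralBox {V : Set (UpperIndex d → ℂ)} {B : Set (sumOnePlane d)}
    {x₀ x : sumOnePlane d} (hx₀ : StrictAnti (x₀ : Fin d → ℝ)) (hx : x ∈ B)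
    {U : unitary (H →L[ℂ] H)} (hU : U ∈ phaseSaturation b V x₀) :
    spectralMapTraceOne b (x, U) ∈ spectralBox b V B := by
  obtain ⟨z, hz, h⟩ := hU
  rw [spectralMapTraceOne_eq_of_injective b hx₀.injective h x]
  exact ⟨(x, unitaryFrame b z), ⟨hx, z, hz, rfl⟩, rfl⟩

lemma spectralMapTraceOne_mem_spectralBox_iff (hd : Module.finrank ℂ H = d)
    {V : Set (UpperIndex d → ℂ)} {B : Set (sumOnePlane d)}
    (hB : B ⊆ {x | StrictAnti (x : Fin d → ℝ)}) {x₀ x : sumOnePlane d}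
    (hx₀ : StrictAnti (x₀ : Fin d → ℝ)) (hx : Antitone (x : Fin d → ℝ))
    {U : unitary (H →L[ℂ] H)} :
    spectralMapTraceOne b (x, U) ∈ spectralBox b V B ↔ x ∈ B ∧ U ∈ phaseSaturation b V x₀ := by
  refine ⟨?_, fun h => spectralMapTraceOne_mem_spectralBox b hx₀ h.1 h.2⟩
  rintro ⟨⟨y, W⟩, ⟨hy, z, hz, rfl⟩, h⟩
  have hyB : StrictAnti (y : Fin d → ℝ) := hB hy
  have hyx : y = x := by
    have := congrArg (orderedEigenvalues hd) h
    rwa [orderedEigenvalues_spectralMapTraceOne b hd _ hyB.antitone,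
      orderedEigenvalues_spectralMapTraceOne b hd _ hx] at this
  subst hyx
  exact ⟨hy, z, hz, spectralMapTraceOne_eq_of_injective b hyB.injective h.symm x₀⟩

lemma spectralBox_eq_image_chart (hd0 : d ≠ 0) (V : Set (UpperIndex d → ℂ))
    (B : Set (sumOnePlane d)) :
    spectralBox b V B = traceOneEquiv b hd0 '' (chart b '' ((planeEquiv hd0 ⁻¹' B) ×ˢ V)) := by
  ext ρ
  simp only [spectralBox, Set.mem_image, Set.mem_prod]
  constructor
  · rintro ⟨⟨x, U⟩, ⟨hx, z, hz, rfl⟩, rfl⟩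
    refine ⟨_, ⟨((planeEquiv hd0).symm x, z), ⟨by simpa using hx, hz⟩, rfl⟩, ?_⟩
    rw [traceOneEquiv_chart, Homeomorph.apply_symm_apply]
    rfl
  · rintro ⟨_, ⟨⟨x, z⟩, ⟨hx, hz⟩, rfl⟩, rfl⟩
    exact ⟨(planeEquiv hd0 x, unitaryFrame b z), ⟨hx, z, hz, rfl⟩,
      (traceOneEquiv_chart b hd0 x z).symm⟩

lemma strictAnti_planeEquiv (hd0 : d ≠ 0) {x : (sumOnePlane d).direction} :
    StrictAnti (planeEquiv hd0 x : Fin d → ℝ) ↔ StrictAnti (x : Fin d → ℝ) := by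
  simp [StrictAnti, coe_planeEquiv, uniformVec]

lemma map_traceOneEquiv_symm_image (hd0 : d ≠ 0) (μ : Measure (traceOneOperators H))
    (s : Set (TracelessCoords d)) :
    μ.map (traceOneEquiv b hd0).symm s = μ (traceOneEquiv b hd0 '' s) := by
  rw [(traceOneEquiv b hd0).image_eq_preimage_symm]
  exact (traceOneEquiv b hd0).symm.toMeasurableEquiv.map_apply s

/-- The volume of a spectral box, by the change of variables formula for `chart`. Boxes over
repeated eigenvalues have measure zero because the Jacobian vanishes there. -/
lemma exists_volume_spectralBox (hd : Module.finrank ℂ H = d) (hd0 : d ≠ 0)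
    {vol : Measure (traceOneOperators H)} (hvol : IsVolumeMeasure (traceOneOperators H) vol)
    {volPlane : Measure (sumOnePlane d)} (hvolPlane : IsVolumeMeasure (sumOnePlane d) volPlane)
    {x₀ : sumOnePlane d} (hx₀ : StrictAnti (x₀ : Fin d → ℝ)) :
    ∃ (V : Set (UpperIndex d → ℂ)) (C : ENNReal), C ≠ 0 ∧
      (∀ B, MeasurableSet B → B ⊆ {x : sumOnePlane d | StrictAnti (x : Fin d → ℝ)} →
        MeasurableSet (spectralBox b V B) ∧
        vol (spectralBox b V B) = C * ∫⁻ x in B, ENNReal.ofReal (sqGap (x : Fin d → ℝ)) ∂volPlane) ∧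
      ∀ B, B ⊆ {x : sumOnePlane d | Antitone (x : Fin d → ℝ) ∧ ¬ StrictAnti (x : Fin d → ℝ)} →
        vol (spectralBox b V B) = 0 := by
  have hν := hvol.isAddHaarMeasure_map_traceOneEquiv b hd0
  have hμ := hvolPlane.isAddHaarMeasure_map_planeEquiv hd0
  set φ := planeEquiv hd0
  set τ := traceOneEquiv b hd0
  set ν := vol.map τ.symm
  set μ := volPlane.map φ.symm
  have hφ : Measurable φ := φ.continuous.measurable
  have hx₀' : StrictAnti (φ.symm x₀ : Fin d → ℝ) := by
    rw [← strictAnti_planeEquiv hd0]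
    exact (φ.apply_symm_apply x₀).symm ▸ hx₀
  obtain ⟨V, hVo, hV0, hVpos, hVinj⟩ := exists_isOpen_injOn_chart b hd0 hx₀'
  have hJ : Measurable fun z => ENNReal.ofReal (frameJacobian b z) :=
    (ENNReal.continuous_ofReal.comp (continuous_frameJacobian b hd0)).measurable
  have hgap : Measurable fun x : (sumOnePlane d).direction =>
      ENNReal.ofReal (sqGap (x : Fin d → ℝ)) :=
    (ENNReal.continuous_ofReal.comp (continuous_sqGap.comp continuous_subtype_val)).measurable
  have : (μ.prod (volume : Measure (UpperIndex d → ℂ))).IsAddHaarMeasure :=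
    Measure.prod.instIsAddHaarMeasure _ _
  set k := ν.addHaarScalarFactor (μ.prod (volume : Measure (UpperIndex d → ℂ)))
  have hk : ν = k • μ.prod (volume : Measure (UpperIndex d → ℂ)) :=
    Measure.isAddLeftInvariant_eq_smul _ _
  have hk0 : k ≠ 0 := (Measure.addHaarScalarFactor_pos_of_isAddHaarMeasure _ _).ne'
  have hderiv : ∀ (s : Set (TracelessCoords d)), ∀ f ∈ s,
      HasFDerivWithinAt (chart b) (chartDeriv b f) s f :=
    fun s f _ => (hasFDerivAt_chart b f).hasFDerivWithinAt
  refine ⟨V, k * ∫⁻ z in V, ENNReal.ofReal (frameJacobian b z), ?_, fun B hB hBs => ?_,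
    fun B hB => ?_⟩
  · refine mul_ne_zero (by exact_mod_cast hk0) ?_
    rw [← pos_iff_ne_zero, setLIntegral_pos_iff hJ]
    have : (Function.support fun z => ENNReal.ofReal (frameJacobian b z)) ∩ V = V :=
      Set.inter_eq_right.mpr fun z hz => (ENNReal.ofReal_pos.mpr (hVpos z hz)).ne'
    rw [this]
    exact hVo.measure_pos _ ⟨0, hV0⟩
  · have hBs' : φ ⁻¹' B ⊆ {x | StrictAnti (x : Fin d → ℝ)} := fun x hx =>
      (strictAnti_planeEquiv hd0).mp (hBs hx)
    have hinj : Set.InjOn (chart b) ((φ ⁻¹' B) ×ˢ V) :=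
      (injOn_chart b hd hd0 hVinj).mono (Set.prod_mono_left hBs')
    have hm : MeasurableSet ((φ ⁻¹' B) ×ˢ V) := (hφ hB).prod hVo.measurableSet
    rw [spectralBox_eq_image_chart b hd0]
    constructor
    · rw [Homeomorph.image_eq_preimage_symm]
      exact τ.symm.continuous.measurable (measurable_image_of_fderivWithin hm (hderiv _) hinj)
    · rw [← map_traceOneEquiv_symm_image, ← lintegral_abs_det_fderiv_eq_addHaar_image ν hm
        (hderiv _) hinj]
      simp_rw [abs_det_chartDeriv, ENNReal.ofReal_mul (sqGap_nonneg _)]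
      rw [hk, Measure.restrict_smul, lintegral_smul_measure, ← Measure.prod_restrict,
        lintegral_prod_mul hgap.aemeasurable hJ.aemeasurable]
      have h1 : ∫⁻ x in B, ENNReal.ofReal (sqGap (x : Fin d → ℝ)) ∂volPlane
          = ∫⁻ x in φ ⁻¹' B, ENNReal.ofReal (sqGap (x : Fin d → ℝ)) ∂μ := by
        conv_lhs => rw [← map_planeEquiv_map_symm hd0 volPlane]
        rw [setLIntegral_map hB measurable_ofReal_sqGap hφ]
        exact lintegral_congr fun x => congrArg ENNReal.ofReal (sqGap_add_uniformVec _)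
      rw [h1, ENNReal.smul_def, smul_eq_mul]
      ring
  · -- The Jacobian vanishes at repeated eigenvalues, so the image is null by Sard's lemma.
    rw [spectralBox_eq_image_chart b hd0, ← map_traceOneEquiv_symm_image]
    refine addHaar_image_eq_zero_of_det_fderivWithin_eq_zero ν (hderiv _) ?_
    rintro ⟨x, z⟩ ⟨hx, -⟩
    have h1 := hB hx
    have h2 : sqGap (x : Fin d → ℝ) = 0 := by
      have := sqGap_eq_zero h1.1 h1.2
      rwa [coe_planeEquiv, sqGap_add_uniformVec] at this
    rw [← abs_eq_zero, abs_det_chartDeriv, h2, zero_mul]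

/-- The eigenvalue distribution of a volume measure on the self-adjoint operators of trace one. By
unitary invariance, the volume of a spectral box is the measure of its set of spectra times the Haar
measure of its set of eigenbases; comparing this with the change of variables formula determines the
eigenvalue distribution up to a factor. -/
theorem exists_map_orderedEigenvalues_apply (hd : Module.finrank ℂ H = d) (hd2 : 2 ≤ d)
    {vol : Measure (traceOneOperators H)} (hvol : IsVolumeMeasure (traceOneOperators H) vol)
    {volPlane : Measure (sumOnePlane d)} (hvolPlane : IsVolumeMeasure (sumOnePlane d) volPlane) :
    ∃ κ : ENNReal, κ ≠ 0 ∧ ∀ B, MeasurableSet B →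
      vol.map (orderedEigenvalues hd) B
        = κ * ∫⁻ x in B ∩ {x | StrictAnti (x : Fin d → ℝ)},
          ENNReal.ofReal (sqGap (x : Fin d → ℝ)) ∂volPlane := by
  have hd0 : d ≠ 0 := by omega
  let b := (stdOrthonormalBasis ℂ H).reindex (finCongr hd)
  obtain ⟨x₀, hx₀, -⟩ := exists_strictAnti_mem_Ioo hd2
  obtain ⟨V, C, hC0, hreg, hsing⟩ := exists_volume_spectralBox b hd hd0 hvol hvolPlane hx₀
  let haar : Measure (unitary (H →L[ℂ] H)) := Measure.haarMeasure ⊤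
  have : IsProbabilityMeasure haar := ⟨Measure.haarMeasure_self (K₀ := ⊤)⟩
  have hoe := measurable_orderedEigenvalues (H := H) hd
  have hspec := (continuous_spectralMapTraceOne b).measurable
  have : SFinite vol := by
    have hHaar := hvol.isAddHaarMeasure_map_traceOneEquiv b hd0
    have h := (traceOneEquiv b hd0).symm.toMeasurableEquiv.map_symm_map (μ := vol)
    have h' : Measure.map (traceOneEquiv b hd0) (vol.map (traceOneEquiv b hd0).symm) = vol := h
    rw [← h']
    infer_instance
  set ν := vol.map (orderedEigenvalues hd)
  have hvolν : (ν.prod haar).map (spectralMapTraceOne b) = vol :=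
    map_spectralMapTraceOne_prod_haar b hd vol (fun U => hvol.map_conjTraceOne hd hd0 U) haar
  have hvolν' : ∀ s, MeasurableSet s →
      vol s = ∫⁻ x, haar {U | spectralMapTraceOne b (x, U) ∈ s} ∂ν := fun s hs => by
    conv_lhs => rw [← hvolν]
    rw [Measure.map_apply hspec hs, Measure.prod_apply (hspec hs)]
    rfl
  have hνae : ∀ᵐ x : sumOnePlane d ∂ν, Antitone (x : Fin d → ℝ) := by
    rw [ae_map_iff hoe.aemeasurable measurableSet_antitone]
    exact ae_of_all _ (antitone_orderedEigenvalues hd)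
  set g := haar (phaseSaturation b V x₀)
  have hg1 : g ≠ ⊤ := measure_ne_top _ _
  have hmain : ∀ B, MeasurableSet B → B ⊆ {x : sumOnePlane d | StrictAnti (x : Fin d → ℝ)} →
      g * ν B = C * ∫⁻ x in B, ENNReal.ofReal (sqGap (x : Fin d → ℝ)) ∂volPlane := by
    intro B hB hBs
    obtain ⟨hm, hv⟩ := hreg B hB hBs
    rw [← hv, hvolν' _ hm, ← lintegral_indicator_const hB]
    refine lintegral_congr_ae (hνae.mono fun x hx => ?_)
    simp only [spectralMapTraceOne_mem_spectralBox_iff b hd hBs hx₀ hx]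
    by_cases hxB : x ∈ B <;> simp [hxB, g]
  have hS : MeasurableSet (orderedSimplex d) := isCompact_orderedSimplex.isClosed.measurableSet
  -- Otherwise the ordered simplex, where the density is not almost everywhere zero, would
  -- contradict `hmain`.
  have hg0 : g ≠ 0 := by
    intro h0
    have h := hmain _ (hS.inter measurableSet_strictAnti) Set.inter_subset_right
    rw [h0, zero_mul] at h
    exact mul_ne_zero hC0 (lintegral_sqGap_orderedSimplex_ne_zero hd2 hvolPlane) h.symm
  have hsing' : ν {x | Antitone (x : Fin d → ℝ) ∧ ¬ StrictAnti (x : Fin d → ℝ)} = 0 := by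
    set Q : Set (sumOnePlane d) := {x | Antitone (x : Fin d → ℝ) ∧ ¬ StrictAnti (x : Fin d → ℝ)}
    have hQ : MeasurableSet Q := measurableSet_antitone.inter measurableSet_strictAnti.compl
    have h0 := hsing Q subset_rfl
    rw [← measure_toMeasurable, hvolν' _ (measurableSet_toMeasurable _ _)] at h0
    have h1 : g * ν Q ≤ 0 := by
      rw [← h0, ← lintegral_indicator_const hQ]
      refine lintegral_mono fun x => ?_
      by_cases hx : x ∈ Q
      · rw [Set.indicator_of_mem hx]
        exact measure_mono fun U hU => subset_toMeasurable _ _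
          (spectralMapTraceOne_mem_spectralBox b hx₀ hx hU)
      · simp [hx]
    exact (mul_eq_zero.mp (le_antisymm h1 bot_le)).resolve_left hg0
  refine ⟨C / g, ENNReal.div_ne_zero.mpr ⟨hC0, hg1⟩, fun B hB => ?_⟩
  have hνB : ν B = ν (B ∩ {x | StrictAnti (x : Fin d → ℝ)}) := by
    refine measure_congr ?_
    have h2 : ∀ᵐ x : sumOnePlane d ∂ν,
        ¬ (Antitone (x : Fin d → ℝ) ∧ ¬ StrictAnti (x : Fin d → ℝ)) :=
      measure_eq_zero_iff_ae_notMem.mp hsing'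
    filter_upwards [hνae, h2] with x hx hx'
    have : StrictAnti (x : Fin d → ℝ) := by tauto
    exact propext ⟨fun h => ⟨h, this⟩, fun h => h.1⟩
  rw [hνB, ENNReal.div_eq_inv_mul, mul_assoc,
    ← hmain _ (hB.inter measurableSet_strictAnti) Set.inter_subset_right, ← mul_assoc,
    ENNReal.inv_mul_cancel hg0 hg1, one_mul]

end EigenvalueDistribution

/-! ### The uniform distribution over the density matrices -/

section UniformDistribution

lemma eigenvalueLaw_apply {d : ℕ} {N : ℝ} (hN : 0 ≤ N) (vol : Measure (sumOnePlane d))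
    {B : Set (sumOnePlane d)} (hB : MeasurableSet B) :
    eigenvalueLaw N vol B = ENNReal.ofReal N * ∫⁻ x in B ∩ orderedSimplex d,
      ENNReal.ofReal (sqGap (x : Fin d → ℝ)) ∂vol := by
  rw [eigenvalueLaw, withDensity_apply _ hB, Measure.restrict_restrict hB,
    ← lintegral_const_mul _ measurable_ofReal_sqGap]
  simp_rw [← ENNReal.ofReal_mul hN, sqGap_eq_prod_Ioi]

/-- On the closed ordered chamber, the Vandermonde determinant vanishes off the open chamber. -/
lemma setLIntegral_inter_strictAnti {d : ℕ} (vol : Measure (sumOnePlane d))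
    {B : Set (sumOnePlane d)} (hB : MeasurableSet B) (hBa : ∀ x ∈ B, Antitone (x : Fin d → ℝ)) :
    ∫⁻ x in B ∩ {x | StrictAnti (x : Fin d → ℝ)}, ENNReal.ofReal (sqGap (x : Fin d → ℝ)) ∂vol
      = ∫⁻ x in B, ENNReal.ofReal (sqGap (x : Fin d → ℝ)) ∂vol := by
  rw [← lintegral_indicator (hB.inter measurableSet_strictAnti), ← lintegral_indicator hB]
  congr 1
  funext x
  by_cases hx : x ∈ B
  · by_cases hx' : StrictAnti (x : Fin d → ℝ)
    · simp [hx, hx']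
    · simp [hx, sqGap_eq_zero (hBa x hx) hx']
  · simp [hx]

end UniformDistribution

end

theorem proposition4 {H : Type*} [NormedAddCommGroup H] [InnerProductSpace ℂ H] [CompleteSpace H]
    [FiniteDimensional ℂ H] {d : ℕ} (hd : Module.finrank ℂ H = d) (hd2 : 2 ≤ d)
    (volPlane : MeasureTheory.Measure (sumOnePlane d))
    (hvolPlane : IsVolumeMeasure (sumOnePlane d) volPlane) :
    ∃ N : ℝ, 0 < N ∧
      ∀ vol : MeasureTheory.Measure (traceOneOperators H),
        IsVolumeMeasure (traceOneOperators H) vol →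
        (uniformDensityMatrix vol).map (orderedEigenvalues hd) = eigenvalueLaw N volPlane ∧
        ∀ (b : OrthonormalBasis (Fin d) ℂ H)
          (haar : MeasureTheory.Measure (unitary (H →L[ℂ] H))),
          haar.IsHaarMeasure → MeasureTheory.IsProbabilityMeasure haar →
          ((eigenvalueLaw N volPlane).prod haar).map (spectralMap b) =
            (uniformDensityMatrix vol).map (fun ρ : traceOneOperators H => (ρ : H →L[ℂ] H)) := by
  have hd0 : d ≠ 0 := by omega
  have hS : MeasurableSet (orderedSimplex d) := isCompact_orderedSimplex.isClosed.measurableSet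
  -- The normalizing constant is the inverse of the total mass `M` of the unnormalized density.
  set M := ∫⁻ x in orderedSimplex d, ENNReal.ofReal (sqGap (x : Fin d → ℝ)) ∂volPlane with hM
  have hMtop : M ≠ ⊤ := (lintegral_sqGap_orderedSimplex_lt_top hvolPlane).ne
  have hM0 : M ≠ 0 := by
    rw [hM, ← setLIntegral_inter_strictAnti volPlane hS fun x hx => hx.2]
    exact lintegral_sqGap_orderedSimplex_ne_zero hd2 hvolPlane
  have hNpos : 0 < M.toReal⁻¹ := inv_pos.mpr (ENNReal.toReal_pos hM0 hMtop)
  have hNM : ENNReal.ofReal M.toReal⁻¹ = M⁻¹ := by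
    rw [ENNReal.ofReal_inv_of_pos (ENNReal.toReal_pos hM0 hMtop), ENNReal.ofReal_toReal hMtop]
  refine ⟨M.toReal⁻¹, hNpos, fun vol hvol => ?_⟩
  have hoe := measurable_orderedEigenvalues (H := H) hd
  obtain ⟨κ, hκ0, hκ⟩ := exists_map_orderedEigenvalues_apply hd hd2 hvol hvolPlane
  have hDm : MeasurableSet (densityMatrices H) := measurableSet_densityMatrices
  have hD : vol (densityMatrices H) = κ * M := by
    rw [densityMatrices_eq_preimage hd, ← Measure.map_apply hoe hS, hκ _ hS,
      setLIntegral_inter_strictAnti volPlane hS fun x hx => hx.2]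
  have hD0 : vol (densityMatrices H) ≠ 0 := hD ▸ mul_ne_zero hκ0 hM0
  have hDtop : vol (densityMatrices H) ≠ ⊤ :=
    (hvol.lt_top_of_isCompact _ isCompact_densityMatrices).ne
  have hκtop : κ ≠ ⊤ := by
    rintro rfl
    rw [ENNReal.top_mul hM0] at hD
    exact hDtop hD
  have hcancel : ∀ I : ENNReal, κ⁻¹ * M⁻¹ * (κ * I) = M⁻¹ * I := fun I => by
    rw [mul_mul_mul_comm, ENNReal.inv_mul_cancel hκ0 hκtop, one_mul]
  have hlaw : (uniformDensityMatrix vol).map (orderedEigenvalues hd)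
      = eigenvalueLaw M.toReal⁻¹ volPlane := by
    refine Measure.ext fun B hB => ?_
    rw [eigenvalueLaw_apply hNpos.le volPlane hB, hNM, Measure.map_apply hoe hB,
      uniformDensityMatrix, ProbabilityTheory.cond_apply hDm, hD, densityMatrices_eq_preimage hd,
      ← Set.preimage_inter, ← Measure.map_apply hoe (hS.inter hB), hκ _ (hS.inter hB),
      setLIntegral_inter_strictAnti volPlane (hS.inter hB) fun x hx => hx.1.2,
      Set.inter_comm B, ENNReal.mul_inv (Or.inl hκ0) (Or.inl hκtop), hcancel]
  refine ⟨hlaw, fun b haar hHaar hprob => ?_⟩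
  have hu : IsProbabilityMeasure (uniformDensityMatrix vol) :=
    ProbabilityTheory.cond_isProbabilityMeasure_of_finite hD0 hDtop
  have hinv : ∀ U : unitary (H →L[ℂ] H),
      (uniformDensityMatrix vol).map (conjTraceOne U) = uniformDensityMatrix vol := by
    intro U
    have hU := measurable_conjTraceOne U
    have hpre : conjTraceOne U ⁻¹' densityMatrices H = densityMatrices H := by
      ext ρ
      rw [densityMatrices_eq_preimage hd, Set.mem_preimage, Set.mem_preimage, Set.mem_preimage]
      obtain ⟨W, hW⟩ := exists_spectralMapTraceOne_eq b hd ρ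
      have h : orderedEigenvalues hd (conjTraceOne U ρ) = orderedEigenvalues hd ρ := by
        conv_lhs => rw [← hW, conjTraceOne_spectralMapTraceOne,
          orderedEigenvalues_spectralMapTraceOne b hd _ (antitone_orderedEigenvalues hd ρ)]
      rw [h]
    refine Measure.ext fun s hs => ?_
    rw [Measure.map_apply hU hs, uniformDensityMatrix, ProbabilityTheory.cond_apply hDm,
      ProbabilityTheory.cond_apply hDm]
    congr 1
    conv_rhs => rw [← hvol.map_conjTraceOne hd hd0 U]
    rw [Measure.map_apply hU (hDm.inter hs), Set.preimage_inter, hpre]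
  have key := map_spectralMapTraceOne_prod_haar b hd (uniformDensityMatrix vol) hinv haar
  conv_rhs => rw [← key]
  rw [Measure.map_map measurable_subtype_coe (continuous_spectralMapTraceOne b).measurable, hlaw]
  rfl
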